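/- Let $\mathbb{D}=\{x\in\mathbb{R}^2:|x|<1\}$ be the Klein model of the hyperbolic plane $\mathbb{H}^2$, with its hyperbolic metric $h_x(v,w)=\frac{\langle v,w\rangle}{1-|x|^2}+\frac{\langle x,v\rangle\langle x,w\rangle}{(1-|x|^2)^2}$ and Levi-Civita connection $\nabla$, and let $\partial\mathbb{H}^2$ be the unit circle. Call a smooth map $F:\mathbb{H}^2\to\mathbb{H}^2$ *minimal Lagrangian* if there is a smooth, $h$-symmetric, positive definite $b\in\Gamma(\mathrm{End}(T\mathbb{H}^2))$ with $F^*h=h(b\,\cdot,b\,\cdot)$ which satisfies the Codazzi equation $d^{\nabla}b=0$, i.e. $(\nabla_v b)(w)=(\nabla_w b)(v)$ for all tangent vectors $v,w$. (Such a map is a local diffeomorphism and $b$ is unique; $F$ is not assumed to be injective.) Let $F:\mathbb{H}^2\to\mathbb{H}^2$ be a minimal Lagrangian map. Then $F$ is a diffeomorphism from $\mathbb{H}^2$ onto the interior of the convex hull of $\overline{F(\mathbb{H}^2)}\cap\partial\mathbb{H}^2$, where the closure is taken in the closed disc $\mathbb{H}^2\cup\partial\mathbb{H}^2$ and the convex hull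 is the (geodesic) convex hull in the closed disc, which in the Klein model is the ordinary Euclidean convex hull. -/

import Mathlib

open Set
open scoped ContDiff

noncomputable section

/-- The Euclidean plane, in which the Klein model of the hyperbolic plane lives. -/
abbrev KPlane : Type := EuclideanSpace ℝ (Fin 2)

/-- The hyperbolic plane in the Klein (projective) model, as a set: the open unit disc.
Hyperbolic geodesics are the straight chords of this disc. -/
def kleinDisc : Set KPlane := Metric.ball 0 1

/-- The boundary at infinity of the hyperbolic plane in the Klein model: the unit circle. -/
def kleinBoundary : Set KPlane := Metric.sphere 0 1

/-- The hyperbolic metric (curvature `-1`) of the Klein model at the point `x`, evaluated on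
tangent vectors `v` and `w`. -/
def kleinMetric (x v w : KPlane) : ℝ :=
  inner ℝ v w / (1 - ‖x‖ ^ 2) + inner ℝ x v * inner ℝ x w / (1 - ‖x‖ ^ 2) ^ 2

/-- The Christoffel symbol `Γ_x(v, w)` of the Levi-Civita connection of `kleinMetric` in the
standard coordinates of the disc, so that `∇_v W = D_v W + Γ(v, W)`. -/
def kleinChristoffel (x v w : KPlane) : KPlane :=
  (1 - ‖x‖ ^ 2)⁻¹ • ((inner ℝ x v : ℝ) • w + (inner ℝ x w : ℝ) • v)

/-- The connection with symbol `kleinChristoffel` is torsion-free. -/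
theorem kleinChristoffel_symm (x v w : KPlane) :
    kleinChristoffel x v w = kleinChristoffel x w v := by
  unfold kleinChristoffel
  rw [add_comm]

/-- The connection with symbol `kleinChristoffel` is compatible with `kleinMetric`; being also
torsion-free, it is the Levi-Civita connection. -/
theorem kleinMetric_compatible {x : KPlane} (hx : x ∈ kleinDisc) (u v w : KPlane) :
    DifferentiableAt ℝ (fun y => kleinMetric y v w) x ∧
    fderiv ℝ (fun y => kleinMetric y v w) x u =
      kleinMetric x (kleinChristoffel x u v) w + kleinMetric x v (kleinChristoffel x u w) := by
  have hn : ‖x‖ < 1 := by simpa [kleinDisc] using hx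
  have hr : (1 : ℝ) - ‖x‖ ^ 2 ≠ 0 := by nlinarith [norm_nonneg x]
  have e1 : HasFDerivAt (fun y : KPlane => 1 - ‖y‖ ^ 2) (-(2 • innerSL ℝ x)) x := by
    simpa using (hasStrictFDerivAt_norm_sq x).hasFDerivAt.const_sub 1
  have e2 : ∀ z : KPlane, HasFDerivAt (fun y : KPlane => (inner ℝ y z : ℝ)) (innerSL ℝ z) x := by
    intro z
    have h := (innerSL ℝ z).hasFDerivAt (x := x)
    simpa [real_inner_comm] using h
  have e3 : HasFDerivAt (fun y : KPlane => (1 - ‖y‖ ^ 2)⁻¹)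
      ((-((1 - ‖x‖ ^ 2) ^ 2)⁻¹) • (-((2 : ℕ) • (innerSL ℝ x : KPlane →L[ℝ] ℝ)))) x :=
    HasDerivAt.comp_hasFDerivAt (h₂ := fun t : ℝ => t⁻¹) x (hasDerivAt_inv hr) e1
  have d := (e3.const_mul (inner ℝ v w : ℝ)).add (((e2 v).mul (e2 w)).mul (e3.mul e3))
  have e : (fun y => kleinMetric y v w) = fun y : KPlane =>
      inner ℝ v w * (1 - ‖y‖ ^ 2)⁻¹ +
        inner ℝ y v * inner ℝ y w * ((1 - ‖y‖ ^ 2)⁻¹ * (1 - ‖y‖ ^ 2)⁻¹) := by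
    funext y
    simp only [kleinMetric, div_eq_mul_inv, sq, mul_inv]
  rw [e]
  refine ⟨d.differentiableAt, ?_⟩
  have d' := congrArg (fun L : KPlane →L[ℝ] ℝ => L u) d.fderiv
  refine d'.trans ?_
  simp only [kleinMetric, kleinChristoffel, inner_add_left, inner_add_right, inner_smul_left,
    inner_smul_right, add_apply, smul_apply, neg_apply,
    innerSL_apply_apply, smul_eq_mul, nsmul_eq_mul, RCLike.conj_to_real, Pi.mul_apply,
    Nat.cast_ofNat]
  rw [real_inner_comm u v, real_inner_comm w v, real_inner_comm u w]
  field_simp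
  ring

/-- The covariant derivative `(∇_v b)(w)` at `x` of a field `b` of endomorphisms of the tangent
bundle of the hyperbolic plane, for the Levi-Civita connection. -/
def covDerivEnd (b : KPlane → KPlane →L[ℝ] KPlane) (x v w : KPlane) : KPlane :=
  fderiv ℝ b x v w + kleinChristoffel x v (b x w) - b x (kleinChristoffel x v w)

/-- The exterior covariant derivative `d^∇ b (v, w) = (∇_v b)(w) - (∇_w b)(v)`. -/
def extCovDeriv (b : KPlane → KPlane →L[ℝ] KPlane) (x v w : KPlane) : KPlane :=
  covDerivEnd b x v w - covDerivEnd b x w v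

/-- Minimal Lagrangian maps from the hyperbolic plane to itself: smooth maps `F` for which the
positive definite, `h`-symmetric tensor `b` with `F^* h = h(b ·, b ·)` satisfies the Codazzi
equation `d^∇ b = 0`. Such a `b` is unique, and it exists exactly when `F` is a local
diffeomorphism; injectivity of `F` is not assumed. The values of `F` and `b` outside the disc
are irrelevant. -/
structure IsMinimalLagrangian (F : KPlane → KPlane) : Prop where
  mapsTo : MapsTo F kleinDisc kleinDisc
  smooth : ContDiffOn ℝ ∞ F kleinDisc
  codazzi : ∃ b : KPlane → KPlane →L[ℝ] KPlane,
    ContDiffOn ℝ ∞ b kleinDisc ∧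
    ∀ x ∈ kleinDisc,
      (∀ v w, kleinMetric x (b x v) w = kleinMetric x v (b x w)) ∧
      (∀ v, v ≠ 0 → 0 < kleinMetric x (b x v) v) ∧
      (∀ v w, kleinMetric (F x) (fderiv ℝ F x v) (fderiv ℝ F x w) =
        kleinMetric x (b x v) (b x w)) ∧
      ∀ v w, extCovDeriv b x v w = 0

/-- `F` restricts to a smooth diffeomorphism from `U` onto `V` (used for open `U` and `V`). -/
def IsDiffeoOnto (F : KPlane → KPlane) (U V : Set KPlane) : Prop :=
  BijOn F U V ∧ ContDiffOn ℝ ∞ F U ∧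
    ∃ G : KPlane → KPlane, ContDiffOn ℝ ∞ G V ∧ InvOn G F U V

end

/-! Let N be the embedding `hypLift` of the disc onto the hyperboloid in Minkowski space and P = N ∘
F. The Codazzi equation and the symmetry of b make the vector-valued 1-form dN ∘ b closed, so it
integrates to a spacelike immersion X with Gauss map N and first fundamental form F^*h
(`exists_immersion`). Since X and P induce the same metric, comparing their Gauss equations gives
det b = 1 (`det_tensor`).

The horizontal part X.1 is strictly monotone (`inner_fst_sub_pos`) with Jacobian (1 - |x|²)⁻²
(`abs_det_fderiv_fst`). If it stayed bounded along a sequence tending to the circle, monotonicity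
would bound it on a whole cone at the limit point, although the image of that cone has infinite
area. So X.1 is proper, and by convexity so is the height X.2 (`exists_norm_lt_of_snd_le`).
Preimages of chords under F are, up to parametrization, geodesics of the metric of X; along them X
accelerates, modulo its velocity, in the direction N, so the height has no interior maximum
(`deriv_deriv_snd_pos`). Lifts of chords between two given points therefore stay in a compact set,
and a continuity argument joins any two points by such a lift (`exists_isSegmentLift`). Hence F is
injective with convex image.

To identify the image, integrate dP ∘ b⁻¹ to the dual immersion W, whose metric is h and whose Gauss
map is P. Completeness of h makes W.1 surjective onto the plane (`exists_dual_fst_eq`), and W.1 is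
monotone as a function of F (`inner_dual_sub_nonneg`). Suppose a half plane cut off a nonempty piece
of the image whose closure lies in the open disc. Then W.1 would map the corresponding region to a
set of finite area, while monotonicity and surjectivity put arbitrarily large discs into it
(`not_subset_kleinDisc`). By Hahn–Banach the image has the same closure as the hull of its ideal
points, and convexity then gives equality of the interiors. -/

noncomputable section

/-! ### Minkowski space and the hyperboloid over the Klein disc. -/

/-- The Minkowski bilinear form of signature `(2, 1)` on `ℝ² × ℝ`. -/
def minkForm (p q : KPlane × ℝ) : ℝ := inner ℝ p.1 q.1 - p.2 * q.2

theorem minkForm_comm (p q : KPlane × ℝ) : minkForm p q = minkForm q p := by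
  unfold minkForm
  rw [real_inner_comm, mul_comm]

theorem minkForm_add_left (p p' q : KPlane × ℝ) :
    minkForm (p + p') q = minkForm p q + minkForm p' q := by
  simp only [minkForm, Prod.fst_add, Prod.snd_add, inner_add_left]
  ring

theorem minkForm_add_right (p q q' : KPlane × ℝ) :
    minkForm p (q + q') = minkForm p q + minkForm p q' := by
  rw [minkForm_comm, minkForm_add_left, minkForm_comm q, minkForm_comm q']

theorem minkForm_smul_left (c : ℝ) (p q : KPlane × ℝ) :
    minkForm (c • p) q = c * minkForm p q := by
  simp only [minkForm, Prod.smul_fst, Prod.smul_snd, real_inner_smul_left, smul_eq_mul]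
  ring

theorem minkForm_smul_right (c : ℝ) (p q : KPlane × ℝ) :
    minkForm p (c • q) = c * minkForm p q := by
  rw [minkForm_comm, minkForm_smul_left, minkForm_comm]

theorem minkForm_zero_left (q : KPlane × ℝ) : minkForm 0 q = 0 := by simp [minkForm]

theorem minkForm_sub_left (p p' q : KPlane × ℝ) :
    minkForm (p - p') q = minkForm p q - minkForm p' q := by
  simp only [minkForm, Prod.fst_sub, Prod.snd_sub, inner_sub_left]
  ring

theorem fderiv_minkForm {f g : KPlane → KPlane × ℝ} {x : KPlane}
    (hf : DifferentiableAt ℝ f x) (hg : DifferentiableAt ℝ g x) (u : KPlane) :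
    fderiv ℝ (fun y => minkForm (f y) (g y)) x u =
      minkForm (fderiv ℝ f x u) (g x) + minkForm (f x) (fderiv ℝ g x u) := by
  have h := (hf.hasFDerivAt.fst.inner ℝ hg.hasFDerivAt.fst).sub
    (hf.hasFDerivAt.snd.mul hg.hasFDerivAt.snd)
  have h' := congrArg (fun L : KPlane →L[ℝ] ℝ => L u) h.fderiv
  refine Eq.trans h' ?_
  simp [minkForm]
  ring

/-- The derivative of a field of linear maps evaluated at a constant vector. -/
theorem hasFDerivAt_fderiv_apply {E : Type*} [NormedAddCommGroup E] [NormedSpace ℝ E]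
    {f : KPlane → KPlane →L[ℝ] E} {x : KPlane} (hf : DifferentiableAt ℝ f x) (v : KPlane) :
    HasFDerivAt (fun y => f y v) ((fderiv ℝ f x).flip v) x := by
  simpa using hf.hasFDerivAt.clm_apply (hasFDerivAt_const v x)

theorem fderiv_clm_apply_const {E : Type*} [NormedAddCommGroup E] [NormedSpace ℝ E]
    {f : KPlane → KPlane →L[ℝ] E} {x : KPlane} (hf : DifferentiableAt ℝ f x) (u v : KPlane) :
    fderiv ℝ (fun y => f y v) x u = fderiv ℝ f x u v := by
  rw [(hasFDerivAt_fderiv_apply hf v).fderiv, ContinuousLinearMap.flip_apply]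

theorem isOpen_kleinDisc : IsOpen kleinDisc := Metric.isOpen_ball

theorem convex_kleinDisc : Convex ℝ kleinDisc := convex_ball 0 1

theorem mem_kleinDisc {x : KPlane} : x ∈ kleinDisc ↔ ‖x‖ < 1 := by simp [kleinDisc]

theorem one_sub_norm_sq_pos {x : KPlane} (hx : x ∈ kleinDisc) : 0 < 1 - ‖x‖ ^ 2 := by
  have := mem_kleinDisc.1 hx
  nlinarith [norm_nonneg x]

/-- The Lorentz factor `(1 - |x|²)^{-1/2}`. -/
def lorentzFactor (x : KPlane) : ℝ := (√(1 - ‖x‖ ^ 2))⁻¹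

theorem lorentzFactor_pos {x : KPlane} (hx : x ∈ kleinDisc) : 0 < lorentzFactor x :=
  inv_pos.2 (Real.sqrt_pos.2 (one_sub_norm_sq_pos hx))

theorem lorentzFactor_sq {x : KPlane} (hx : x ∈ kleinDisc) :
    lorentzFactor x ^ 2 = (1 - ‖x‖ ^ 2)⁻¹ := by
  rw [lorentzFactor, inv_pow, Real.sq_sqrt (one_sub_norm_sq_pos hx).le]

theorem lorentzFactor_sq_mul {x : KPlane} (hx : x ∈ kleinDisc) :
    lorentzFactor x ^ 2 * (1 - ‖x‖ ^ 2) = 1 := by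
  rw [lorentzFactor_sq hx, inv_mul_cancel₀ (one_sub_norm_sq_pos hx).ne']

theorem kleinMetric_eq {x : KPlane} (hx : x ∈ kleinDisc) (v w : KPlane) :
    kleinMetric x v w =
      lorentzFactor x ^ 2 * inner ℝ v w + lorentzFactor x ^ 4 * (inner ℝ x v * inner ℝ x w) := by
  have h := (one_sub_norm_sq_pos hx).ne'
  rw [kleinMetric, show lorentzFactor x ^ 4 = (lorentzFactor x ^ 2) ^ 2 by ring,
    lorentzFactor_sq hx]
  field_simp

theorem kleinMetric_symm (x v w : KPlane) : kleinMetric x v w = kleinMetric x w v := by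
  unfold kleinMetric
  rw [real_inner_comm, mul_comm]

theorem inner_sq_div_le_kleinMetric {x : KPlane} (hx : x ∈ kleinDisc) (v : KPlane) :
    (inner ℝ x v / (1 - ‖x‖ ^ 2)) ^ 2 ≤ kleinMetric x v v := by
  have h := one_sub_norm_sq_pos hx
  rw [kleinMetric, div_pow, ← sq, real_inner_self_eq_norm_sq]
  have : 0 ≤ ‖v‖ ^ 2 / (1 - ‖x‖ ^ 2) := by positivity
  linarith

theorem kleinMetric_pos {x : KPlane} (hx : x ∈ kleinDisc) {v : KPlane} (hv : v ≠ 0) :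
    0 < kleinMetric x v v := by
  have h := one_sub_norm_sq_pos hx
  rw [kleinMetric, real_inner_self_eq_norm_sq, ← sq]
  have : 0 < ‖v‖ ^ 2 / (1 - ‖x‖ ^ 2) := by
    have := norm_pos_iff.2 hv
    positivity
  positivity

theorem hasFDerivAt_lorentzFactor {x : KPlane} (hx : x ∈ kleinDisc) :
    HasFDerivAt lorentzFactor (lorentzFactor x ^ 3 • innerSL ℝ x) x := by
  have hr := one_sub_norm_sq_pos hx
  have e1 : HasFDerivAt (fun y : KPlane => 1 - ‖y‖ ^ 2) (-(2 • innerSL ℝ x)) x := by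
    simpa using (hasStrictFDerivAt_norm_sq x).hasFDerivAt.const_sub 1
  have e2 := e1.sqrt hr.ne'
  have e3 := HasDerivAt.comp_hasFDerivAt (h₂ := fun t : ℝ => t⁻¹) x
    (hasDerivAt_inv (Real.sqrt_pos.2 hr).ne') e2
  refine e3.congr_fderiv ?_
  ext v
  have h1 := Real.sqrt_pos.2 hr
  simp [lorentzFactor]
  field_simp

theorem contDiffAt_lorentzFactor {x : KPlane} (hx : x ∈ kleinDisc) :
    ContDiffAt ℝ ∞ lorentzFactor x := by
  have hr := one_sub_norm_sq_pos hx
  refine ContDiffAt.inv (ContDiffAt.sqrt ?_ hr.ne') (Real.sqrt_pos.2 hr).ne'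
  exact contDiffAt_const.sub (contDiff_norm_sq ℝ).contDiffAt

/-- The radial lift of the Klein disc to the hyperboloid in Minkowski space. -/
def hypLift (x : KPlane) : KPlane × ℝ := lorentzFactor x • (x, (1 : ℝ))

theorem contDiffAt_hypLift {x : KPlane} (hx : x ∈ kleinDisc) : ContDiffAt ℝ ∞ hypLift x :=
  (contDiffAt_lorentzFactor hx).smul (contDiffAt_id.prodMk contDiffAt_const)

theorem fderiv_hypLift {x : KPlane} (hx : x ∈ kleinDisc) (v : KPlane) :
    fderiv ℝ hypLift x v = lorentzFactor x • (v, (0 : ℝ)) +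
      (lorentzFactor x ^ 3 * inner ℝ x v) • (x, (1 : ℝ)) := by
  have h := (hasFDerivAt_lorentzFactor hx).smul
    ((hasFDerivAt_id x).prodMk (hasFDerivAt_const (1 : ℝ) x))
  have h' := congrArg (fun L : KPlane →L[ℝ] KPlane × ℝ => L v) h.fderiv
  refine Eq.trans h' ?_
  simp

theorem minkForm_hypLift_self {x : KPlane} (hx : x ∈ kleinDisc) :
    minkForm (hypLift x) (hypLift x) = -1 := by
  rw [hypLift, minkForm_smul_left, minkForm_smul_right, minkForm, real_inner_self_eq_norm_sq]
  linear_combination -lorentzFactor_sq_mul hx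

theorem minkForm_hypLift_fderiv {x : KPlane} (hx : x ∈ kleinDisc) (v : KPlane) :
    minkForm (hypLift x) (fderiv ℝ hypLift x v) = 0 := by
  rw [fderiv_hypLift hx, hypLift, minkForm_smul_left, minkForm_add_right, minkForm_smul_right,
    minkForm_smul_right, minkForm, minkForm, real_inner_self_eq_norm_sq]
  linear_combination -lorentzFactor x ^ 2 * inner ℝ x v * lorentzFactor_sq_mul hx

theorem minkForm_fderiv_hypLift {x : KPlane} (hx : x ∈ kleinDisc) (v w : KPlane) :
    minkForm (fderiv ℝ hypLift x v) (fderiv ℝ hypLift x w) = kleinMetric x v w := by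
  rw [fderiv_hypLift hx, fderiv_hypLift hx, kleinMetric_eq hx]
  simp only [minkForm_add_left, minkForm_add_right, minkForm_smul_left, minkForm_smul_right]
  simp only [minkForm, real_inner_self_eq_norm_sq, real_inner_comm x v]
  linear_combination -lorentzFactor x ^ 4 * inner ℝ x v * inner ℝ x w * lorentzFactor_sq_mul hx

/-- This is Gauss' formula for the hyperboloid: the tangential part is the Levi-Civita connection,
and the normal part is the metric itself because the position vector is the unit normal. -/
theorem fderiv_fderiv_hypLift {x : KPlane} (hx : x ∈ kleinDisc) (u v : KPlane) :
    fderiv ℝ (fderiv ℝ hypLift) x u v =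
      fderiv ℝ hypLift x (kleinChristoffel x u v) + kleinMetric x u v • hypLift x := by
  have hd : DifferentiableAt ℝ (fderiv ℝ hypLift) x :=
    ((contDiffAt_hypLift hx).fderiv_right (m := 1) (by norm_cast)).differentiableAt (by norm_num)
  rw [← fderiv_clm_apply_const hd]
  have hev : (fun y => fderiv ℝ hypLift y v) =ᶠ[nhds x] fun y => lorentzFactor y • (v, (0 : ℝ)) +
      (lorentzFactor y ^ 3 * inner ℝ y v) • (y, (1 : ℝ)) := by
    filter_upwards [isOpen_kleinDisc.mem_nhds hx] with y hy using fderiv_hypLift hy v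
  rw [hev.fderiv_eq]
  have hk := hasFDerivAt_lorentzFactor hx
  have e2 : HasFDerivAt (fun y : KPlane => (inner ℝ y v : ℝ)) (innerSL ℝ v) x := by
    have h := (innerSL ℝ v).hasFDerivAt (x := x)
    simpa [real_inner_comm] using h
  have h := (hk.smul (hasFDerivAt_const (v, (0 : ℝ)) x)).add
    (((hk.pow 3).mul e2).smul ((hasFDerivAt_id x).prodMk (hasFDerivAt_const (1 : ℝ) x)))
  have h' := congrArg (fun L : KPlane →L[ℝ] KPlane × ℝ => L u) h.fderiv
  refine Eq.trans h' ?_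
  rw [fderiv_hypLift hx, kleinMetric_eq hx, kleinChristoffel, hypLift, ← lorentzFactor_sq hx]
  have hi := real_inner_self_eq_norm_sq x
  ext1
  · simp [inner_add_right, real_inner_smul_right, real_inner_comm u v]
    module
  · simp [inner_add_right, real_inner_smul_right, real_inner_comm u v]
    ring

/-! ### Immersions with equal first fundamental forms. -/

theorem ContDiffOn.fderiv_infty {E F : Type*} [NormedAddCommGroup E] [NormedSpace ℝ E]
    [NormedAddCommGroup F] [NormedSpace ℝ F] {f : E → F} {s : Set E} (hf : ContDiffOn ℝ ∞ f s)
    (hs : IsOpen s) : ContDiffOn ℝ ∞ (fderiv ℝ f) s :=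
  hf.fderiv_of_isOpen hs (by norm_cast)

theorem ContDiffOn.differentiableAt_of_isOpen {E F : Type*} [NormedAddCommGroup E]
    [NormedSpace ℝ E] [NormedAddCommGroup F] [NormedSpace ℝ F] {f : E → F} {s : Set E}
    (hf : ContDiffOn ℝ ∞ f s) (hs : IsOpen s) {x : E} (hx : x ∈ s) : DifferentiableAt ℝ f x :=
  (hf.contDiffAt (hs.mem_nhds hx)).differentiableAt (by simp)

theorem ContDiffOn.fderiv_fderiv_comm {E F : Type*} [NormedAddCommGroup E]
    [NormedSpace ℝ E] [NormedAddCommGroup F] [NormedSpace ℝ F] {f : E → F} {s : Set E}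
    (hf : ContDiffOn ℝ ∞ f s) (hs : IsOpen s) {x : E} (hx : x ∈ s) (u v : E) :
    fderiv ℝ (fderiv ℝ f) x u v = fderiv ℝ (fderiv ℝ f) x v u :=
  ((hf.contDiffAt (hs.mem_nhds hx)).isSymmSndFDerivAt (by
    rw [minSmoothness_of_isRCLikeNormedField]
    norm_cast)).eq u v

/-- Two immersions into Minkowski space with the same first fundamental form have second
derivatives with the same tangential components. -/
theorem minkForm_fderiv_fderiv_eq {X P : KPlane → KPlane × ℝ} {s : Set KPlane} (hs : IsOpen s)
    (hX : ContDiffOn ℝ ∞ X s) (hP : ContDiffOn ℝ ∞ P s)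
    (hiso : ∀ y ∈ s, ∀ v w, minkForm (fderiv ℝ X y v) (fderiv ℝ X y w) =
      minkForm (fderiv ℝ P y v) (fderiv ℝ P y w)) {x : KPlane} (hx : x ∈ s) (u v w : KPlane) :
    minkForm (fderiv ℝ (fderiv ℝ X) x u v) (fderiv ℝ X x w) =
      minkForm (fderiv ℝ (fderiv ℝ P) x u v) (fderiv ℝ P x w) := by
  have hX1 := (hX.fderiv_infty hs).differentiableAt_of_isOpen hs hx
  have hP1 := (hP.fderiv_infty hs).differentiableAt_of_isOpen hs hx
  have key : ∀ a b c : KPlane,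
      minkForm (fderiv ℝ (fderiv ℝ X) x a b) (fderiv ℝ X x c) +
        minkForm (fderiv ℝ X x b) (fderiv ℝ (fderiv ℝ X) x a c) =
      minkForm (fderiv ℝ (fderiv ℝ P) x a b) (fderiv ℝ P x c) +
        minkForm (fderiv ℝ P x b) (fderiv ℝ (fderiv ℝ P) x a c) := by
    intro a b c
    have hev : (fun y => minkForm (fderiv ℝ X y b) (fderiv ℝ X y c)) =ᶠ[nhds x]
        fun y => minkForm (fderiv ℝ P y b) (fderiv ℝ P y c) := by
      filter_upwards [hs.mem_nhds hx] with y hy using hiso y hy b c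
    have h := congrArg (fun L : KPlane →L[ℝ] ℝ => L a) hev.fderiv_eq
    rw [fderiv_minkForm (hasFDerivAt_fderiv_apply hX1 b).differentiableAt
      (hasFDerivAt_fderiv_apply hX1 c).differentiableAt,
      fderiv_minkForm (hasFDerivAt_fderiv_apply hP1 b).differentiableAt
      (hasFDerivAt_fderiv_apply hP1 c).differentiableAt, fderiv_clm_apply_const hX1,
      fderiv_clm_apply_const hX1, fderiv_clm_apply_const hP1, fderiv_clm_apply_const hP1] at h
    exact h
  -- The Koszul trick: the cyclic combination of the three differentiated metric identities isolates
  -- one second derivative, because second derivatives are symmetric.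
  have h1 := key u v w
  have h2 := key v w u
  have h3 := key w u v
  rw [hX.fderiv_fderiv_comm hs hx v u, hP.fderiv_fderiv_comm hs hx v u] at h2
  rw [hX.fderiv_fderiv_comm hs hx w u, hP.fderiv_fderiv_comm hs hx w u,
    hX.fderiv_fderiv_comm hs hx w v, hP.fderiv_fderiv_comm hs hx w v] at h3
  simp only [minkForm_comm (fderiv ℝ X x _), minkForm_comm (fderiv ℝ P x _)] at h1 h2 h3
  linarith

/-- The part of Gauss' equation which only depends on the first fundamental form. -/
theorem minkForm_gauss_eq {X P : KPlane → KPlane × ℝ} {s : Set KPlane} (hs : IsOpen s)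
    (hX : ContDiffOn ℝ ∞ X s) (hP : ContDiffOn ℝ ∞ P s)
    (hiso : ∀ y ∈ s, ∀ v w, minkForm (fderiv ℝ X y v) (fderiv ℝ X y w) =
      minkForm (fderiv ℝ P y v) (fderiv ℝ P y w)) {x : KPlane} (hx : x ∈ s) (u v : KPlane) :
    minkForm (fderiv ℝ (fderiv ℝ X) x u u) (fderiv ℝ (fderiv ℝ X) x v v) -
        minkForm (fderiv ℝ (fderiv ℝ X) x u v) (fderiv ℝ (fderiv ℝ X) x u v) =
      minkForm (fderiv ℝ (fderiv ℝ P) x u u) (fderiv ℝ (fderiv ℝ P) x v v) -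
        minkForm (fderiv ℝ (fderiv ℝ P) x u v) (fderiv ℝ (fderiv ℝ P) x u v) := by
  -- The third derivatives of `Q` cancel by symmetry, so the expression involves only derivatives of
  -- tangential components, and these are determined by the metric.
  have gen : ∀ {Q : KPlane → KPlane × ℝ}, ContDiffOn ℝ ∞ Q s →
      minkForm (fderiv ℝ (fderiv ℝ Q) x u u) (fderiv ℝ (fderiv ℝ Q) x v v) -
        minkForm (fderiv ℝ (fderiv ℝ Q) x u v) (fderiv ℝ (fderiv ℝ Q) x u v) =
      fderiv ℝ (fun y => minkForm (fderiv ℝ (fderiv ℝ Q) y u u) (fderiv ℝ Q y v)) x v -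
        fderiv ℝ (fun y => minkForm (fderiv ℝ (fderiv ℝ Q) y u v) (fderiv ℝ Q y v)) x u := by
    intro Q hQ
    have hQ1 := (hQ.fderiv_infty hs).differentiableAt_of_isOpen hs hx
    have hQ2 := ((hQ.fderiv_infty hs).fderiv_infty hs).differentiableAt_of_isOpen hs hx
    have hd : ∀ a b : KPlane, DifferentiableAt ℝ (fun y => fderiv ℝ (fderiv ℝ Q) y a b) x :=
      fun a b => (hQ2.clm_apply (differentiableAt_const a)).clm_apply (differentiableAt_const b)
    rw [fderiv_minkForm (hd u u) (hasFDerivAt_fderiv_apply hQ1 v).differentiableAt,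
      fderiv_minkForm (hd u v) (hasFDerivAt_fderiv_apply hQ1 v).differentiableAt,
      fderiv_clm_apply_const hQ1, fderiv_clm_apply_const hQ1]
    have hg : ContDiffOn ℝ ∞ (fun y => fderiv ℝ Q y u) s :=
      (hQ.fderiv_infty hs).clm_apply contDiffOn_const
    have hg1 := (hg.fderiv_infty hs).differentiableAt_of_isOpen hs hx
    have hsym := hg.fderiv_fderiv_comm hs hx v u
    rw [← fderiv_clm_apply_const hg1, ← fderiv_clm_apply_const hg1] at hsym
    have e1 : (fun y => fderiv ℝ (fun y => fderiv ℝ Q y u) y u) =ᶠ[nhds x]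
        fun y => fderiv ℝ (fderiv ℝ Q) y u u := by
      filter_upwards [hs.mem_nhds hx] with y hy using
        fderiv_clm_apply_const ((hQ.fderiv_infty hs).differentiableAt_of_isOpen hs hy) u u
    have e2 : (fun y => fderiv ℝ (fun y => fderiv ℝ Q y u) y v) =ᶠ[nhds x]
        fun y => fderiv ℝ (fderiv ℝ Q) y u v := by
      filter_upwards [hs.mem_nhds hx] with y hy
      rw [fderiv_clm_apply_const ((hQ.fderiv_infty hs).differentiableAt_of_isOpen hs hy),
        hQ.fderiv_fderiv_comm hs hy]
    rw [e1.fderiv_eq, e2.fderiv_eq] at hsym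
    rw [hsym]
    ring
  rw [gen hX, gen hP]
  have e : ∀ a b : KPlane, (fun y => minkForm (fderiv ℝ (fderiv ℝ X) y a b) (fderiv ℝ X y v))
      =ᶠ[nhds x] fun y => minkForm (fderiv ℝ (fderiv ℝ P) y a b) (fderiv ℝ P y v) := by
    intro a b
    filter_upwards [hs.mem_nhds hx] with y hy using
      minkForm_fderiv_fderiv_eq hs hX hP hiso hy a b v
  rw [(e u u).fderiv_eq, (e u v).fderiv_eq]

/-- The vectors orthogonal to the hyperboloid at `hypLift x` are tangent to it. -/
theorem exists_fderiv_hypLift_eq {x : KPlane} (hx : x ∈ kleinDisc) {p : KPlane × ℝ}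
    (hp : minkForm p (hypLift x) = 0) : ∃ a, fderiv ℝ hypLift x a = p := by
  have hk := lorentzFactor_pos hx
  have hk2 := lorentzFactor_sq_mul hx
  have hp' : inner ℝ p.1 x = p.2 := by
    rw [hypLift, minkForm_smul_right, mul_eq_zero, minkForm] at hp
    have := hp.resolve_left hk.ne'
    simp only [mul_one] at this
    linarith
  refine ⟨(lorentzFactor x)⁻¹ • (p.1 - p.2 • x), ?_⟩
  have hi : lorentzFactor x ^ 3 * inner ℝ x ((lorentzFactor x)⁻¹ • (p.1 - p.2 • x)) = p.2 := by
    rw [real_inner_smul_right, inner_sub_right, real_inner_smul_right,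
      real_inner_self_eq_norm_sq, real_inner_comm, hp']
    field_simp
    linear_combination p.2 * hk2
  rw [fderiv_hypLift hx, hi]
  ext1
  · simp [smul_smul, mul_inv_cancel₀ hk.ne']
  · simp

theorem fderiv_hypLift_injective {x : KPlane} (hx : x ∈ kleinDisc) {a a' : KPlane}
    (h : fderiv ℝ hypLift x a = fderiv ℝ hypLift x a') : a = a' := by
  by_contra hne
  have := kleinMetric_pos hx (sub_ne_zero.2 hne)
  rw [← minkForm_fderiv_hypLift hx, map_sub, h, sub_self, minkForm_zero_left] at this
  exact this.false

/-! ### Codazzi tensors and the associated immersion. -/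

/-- A minimal Lagrangian map `F` together with its Codazzi tensor `b`. -/
structure IsCodazziPair (F : KPlane → KPlane) (b : KPlane → KPlane →L[ℝ] KPlane) : Prop where
  mapsTo : MapsTo F kleinDisc kleinDisc
  smooth : ContDiffOn ℝ ∞ F kleinDisc
  smooth_tensor : ContDiffOn ℝ ∞ b kleinDisc
  symm : ∀ x ∈ kleinDisc, ∀ v w, kleinMetric x (b x v) w = kleinMetric x v (b x w)
  pos : ∀ x ∈ kleinDisc, ∀ v, v ≠ 0 → 0 < kleinMetric x (b x v) v
  metric : ∀ x ∈ kleinDisc, ∀ v w,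
    kleinMetric (F x) (fderiv ℝ F x v) (fderiv ℝ F x w) = kleinMetric x (b x v) (b x w)
  codazzi : ∀ x ∈ kleinDisc, ∀ v w, extCovDeriv b x v w = 0

theorem IsMinimalLagrangian.exists_isCodazziPair {F : KPlane → KPlane}
    (hF : IsMinimalLagrangian F) : ∃ b, IsCodazziPair F b := by
  obtain ⟨b, hb, h⟩ := hF.codazzi
  exact ⟨b, hF.mapsTo, hF.smooth, hb, fun x hx => (h x hx).1, fun x hx => (h x hx).2.1,
    fun x hx => (h x hx).2.2.1, fun x hx => (h x hx).2.2.2⟩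

theorem contDiffOn_hypLift : ContDiffOn ℝ ∞ hypLift kleinDisc :=
  fun _ hx => (contDiffAt_hypLift hx).contDiffWithinAt

theorem contDiffOn_of_hasFDerivAt {E F : Type*} [NormedAddCommGroup E] [NormedSpace ℝ E]
    [NormedAddCommGroup F] [NormedSpace ℝ F] {f : E → F} {f' : E → E →L[ℝ] F} {s : Set E}
    (hs : IsOpen s) (hf : ∀ x ∈ s, HasFDerivAt f (f' x) x) (hf' : ContDiffOn ℝ ∞ f' s) :
    ContDiffOn ℝ ∞ f s :=
  (contDiffOn_infty_iff_fderiv_of_isOpen hs).2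
    ⟨fun x hx => (hf x hx).differentiableAt.differentiableWithinAt,
      hf'.congr fun x hx => (hf x hx).fderiv⟩

/-- The wedge product of two vectors of the plane. -/
def wedge (v w : KPlane) : ℝ := v 0 * w 1 - v 1 * w 0

theorem inner_eq_coord (v w : KPlane) : inner ℝ v w = v 0 * w 0 + v 1 * w 1 := by
  simp [PiLp.inner_apply, Fin.sum_univ_two]
  ring

theorem norm_sq_eq_coord (v : KPlane) : ‖v‖ ^ 2 = v 0 ^ 2 + v 1 ^ 2 := by
  rw [← real_inner_self_eq_norm_sq, inner_eq_coord]
  ring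

/-- The factor `lorentzFactor x ^ 6` is the determinant of the matrix of the metric in standard
coordinates. -/
theorem kleinMetric_gram {x : KPlane} (hx : x ∈ kleinDisc) (v w v' w' : KPlane) :
    kleinMetric x v v' * kleinMetric x w w' - kleinMetric x v w' * kleinMetric x w v' =
      lorentzFactor x ^ 6 * (wedge v w * wedge v' w') := by
  have h := lorentzFactor_sq_mul hx
  simp only [kleinMetric_eq hx, inner_eq_coord, norm_sq_eq_coord, wedge] at h ⊢
  linear_combination -lorentzFactor x ^ 4 * (v 0 * w 1 - v 1 * w 0) *
    (v' 0 * w' 1 - v' 1 * w' 0) * h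

/-- The restriction of the Minkowski form to the orthogonal of `(x, 1)`, parametrized by the
first component. -/
theorem minkForm_orthogonal_gram (x v w : KPlane) :
    (inner ℝ v v - inner ℝ x v * inner ℝ x v) * (inner ℝ w w - inner ℝ x w * inner ℝ x w) -
      (inner ℝ v w - inner ℝ x v * inner ℝ x w) ^ 2 = (1 - ‖x‖ ^ 2) * wedge v w ^ 2 := by
  simp only [inner_eq_coord, norm_sq_eq_coord, wedge]
  ring

theorem det_eq_wedge (L : KPlane →L[ℝ] KPlane) :
    L.det = wedge (L (EuclideanSpace.single 0 1)) (L (EuclideanSpace.single 1 1)) := by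
  rw [ContinuousLinearMap.det, ← LinearMap.det_toMatrix (EuclideanSpace.basisFun (Fin 2) ℝ).toBasis,
    Matrix.det_fin_two]
  simp [LinearMap.toMatrix_apply, wedge]
  ring

theorem wedge_single : wedge (EuclideanSpace.single 0 1) (EuclideanSpace.single 1 1) = 1 := by
  simp [wedge]

theorem surjective_of_forall_ne_zero {L : KPlane →L[ℝ] KPlane} (h : ∀ v, v ≠ 0 → L v ≠ 0) :
    Function.Surjective L := by
  have : Function.Injective (L : KPlane →ₗ[ℝ] KPlane) := by
    refine (injective_iff_map_eq_zero _).2 fun v hv => ?_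
    by_contra hne
    exact h v hne hv
  exact LinearMap.injective_iff_surjective.1 this

namespace IsCodazziPair

variable {F : KPlane → KPlane} {b : KPlane → KPlane →L[ℝ] KPlane}

theorem tensor_ne_zero (h : IsCodazziPair F b) {x : KPlane} (hx : x ∈ kleinDisc) {v : KPlane}
    (hv : v ≠ 0) : b x v ≠ 0 := by
  intro h0
  have := h.pos x hx v hv
  rw [h0, kleinMetric] at this
  simp at this

theorem fderiv_ne_zero (h : IsCodazziPair F b) {x : KPlane} (hx : x ∈ kleinDisc) {v : KPlane}
    (hv : v ≠ 0) : fderiv ℝ F x v ≠ 0 := by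
  intro h0
  have h1 := kleinMetric_pos hx (h.tensor_ne_zero hx hv)
  rw [← h.metric x hx, h0, kleinMetric] at h1
  simp at h1

/-- The immersion into Minkowski space with Gauss map `hypLift` and inverse shape operator `b`. -/
theorem exists_immersion (h : IsCodazziPair F b) :
    ∃ X : KPlane → KPlane × ℝ,
      ∀ x ∈ kleinDisc, HasFDerivAt X ((fderiv ℝ hypLift x).comp (b x)) x := by
  have hN := contDiffOn_hypLift.fderiv_infty isOpen_kleinDisc
  refine convex_kleinDisc.exists_forall_hasFDerivAt_of_fderiv_symmetric isOpen_kleinDisc ?_ ?_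
  · exact (hN.clm_comp h.smooth_tensor).differentiableOn (by simp)
  · intro x hx u v
    have hN1 := hN.differentiableAt_of_isOpen isOpen_kleinDisc hx
    have hb1 := h.smooth_tensor.differentiableAt_of_isOpen isOpen_kleinDisc hx
    have e := (hN1.hasFDerivAt.clm_comp hb1.hasFDerivAt).fderiv
    rw [e]
    -- Closedness of dN ∘ b splits along the Gauss formula of the hyperboloid: the tangential part
    -- is the Codazzi equation, the coefficient of `hypLift x` is the symmetry of `b`.
    have hc := h.codazzi x hx u v
    simp only [extCovDeriv, covDerivEnd, kleinChristoffel_symm x v u] at hc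
    have hc' : fderiv ℝ b x u v + kleinChristoffel x u (b x v) =
        fderiv ℝ b x v u + kleinChristoffel x v (b x u) := by
      rw [← sub_eq_zero, ← hc]
      abel
    have hs : kleinMetric x u (b x v) = kleinMetric x v (b x u) := by
      rw [← h.symm x hx, kleinMetric_symm]
    have hc'' := congrArg (fderiv ℝ hypLift x) hc'
    simp only [map_add] at hc''
    simp only [add_apply, ContinuousLinearMap.comp_apply, ContinuousLinearMap.flip_apply,
      ContinuousLinearMap.compL_apply, fderiv_fderiv_hypLift hx, hs]
    rw [← add_assoc, hc'', add_assoc]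

end IsCodazziPair

/-! ### Gauss' formula and the determinant of the tensor. -/

/-- The data of a minimal Lagrangian map `F`, its tensor `b` and the immersion `X` into Minkowski
space with first fundamental form `F^* h` and Gauss map `hypLift`. -/
structure IsCodazziImmersion (F : KPlane → KPlane) (b : KPlane → KPlane →L[ℝ] KPlane)
    (X : KPlane → KPlane × ℝ) : Prop extends IsCodazziPair F b where
  hasFDerivAt : ∀ x ∈ kleinDisc, HasFDerivAt X ((fderiv ℝ hypLift x).comp (b x)) x

namespace IsCodazziImmersion

variable {F : KPlane → KPlane} {b : KPlane → KPlane →L[ℝ] KPlane} {X : KPlane → KPlane × ℝ}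

theorem contDiffOn (h : IsCodazziImmersion F b X) : ContDiffOn ℝ ∞ X kleinDisc :=
  contDiffOn_of_hasFDerivAt isOpen_kleinDisc h.hasFDerivAt
    ((contDiffOn_hypLift.fderiv_infty isOpen_kleinDisc).clm_comp h.smooth_tensor)

theorem fderiv_apply (h : IsCodazziImmersion F b X) {x : KPlane} (hx : x ∈ kleinDisc)
    (v : KPlane) : fderiv ℝ X x v = fderiv ℝ hypLift x (b x v) := by
  rw [(h.hasFDerivAt x hx).fderiv, ContinuousLinearMap.comp_apply]

theorem contDiffOn_lift (h : IsCodazziImmersion F b X) :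
    ContDiffOn ℝ ∞ (fun y => hypLift (F y)) kleinDisc :=
  contDiffOn_hypLift.comp h.smooth h.mapsTo

theorem fderiv_lift (h : IsCodazziImmersion F b X) {x : KPlane} (hx : x ∈ kleinDisc)
    (v : KPlane) :
    fderiv ℝ (fun y => hypLift (F y)) x v = fderiv ℝ hypLift (F x) (fderiv ℝ F x v) := by
  have h1 := contDiffOn_hypLift.differentiableAt_of_isOpen isOpen_kleinDisc (h.mapsTo hx)
  have h2 := h.smooth.differentiableAt_of_isOpen isOpen_kleinDisc hx
  have := (h1.hasFDerivAt.comp x h2.hasFDerivAt).fderiv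
  exact congrArg (fun L : KPlane →L[ℝ] KPlane × ℝ => L v) this

theorem minkForm_fderiv_lift (h : IsCodazziImmersion F b X) {x : KPlane} (hx : x ∈ kleinDisc)
    (v w : KPlane) :
    minkForm (fderiv ℝ (fun y => hypLift (F y)) x v) (fderiv ℝ (fun y => hypLift (F y)) x w) =
      kleinMetric x (b x v) (b x w) := by
  rw [h.fderiv_lift hx, h.fderiv_lift hx, minkForm_fderiv_hypLift (h.mapsTo hx), h.metric x hx]

theorem minkForm_fderiv (h : IsCodazziImmersion F b X) {x : KPlane} (hx : x ∈ kleinDisc)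
    (v w : KPlane) : minkForm (fderiv ℝ X x v) (fderiv ℝ X x w) = kleinMetric x (b x v) (b x w) := by
  rw [h.fderiv_apply hx, h.fderiv_apply hx, minkForm_fderiv_hypLift hx]

theorem minkForm_fderiv_eq (h : IsCodazziImmersion F b X) {x : KPlane} (hx : x ∈ kleinDisc)
    (v w : KPlane) : minkForm (fderiv ℝ X x v) (fderiv ℝ X x w) =
      minkForm (fderiv ℝ (fun y => hypLift (F y)) x v)
        (fderiv ℝ (fun y => hypLift (F y)) x w) := by
  rw [h.minkForm_fderiv hx, h.minkForm_fderiv_lift hx]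

theorem minkForm_fderiv_hypLift_eq_zero (h : IsCodazziImmersion F b X) {x : KPlane}
    (hx : x ∈ kleinDisc) (v : KPlane) : minkForm (fderiv ℝ X x v) (hypLift x) = 0 := by
  rw [h.fderiv_apply hx, minkForm_comm, minkForm_hypLift_fderiv hx]

theorem minkForm_fderiv_lift_eq_zero (h : IsCodazziImmersion F b X) {x : KPlane}
    (hx : x ∈ kleinDisc) (v : KPlane) :
    minkForm (fderiv ℝ (fun y => hypLift (F y)) x v) (hypLift (F x)) = 0 := by
  rw [h.fderiv_lift hx, minkForm_comm, minkForm_hypLift_fderiv (h.mapsTo hx)]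

theorem fderiv_injective (h : IsCodazziImmersion F b X) {x : KPlane} (hx : x ∈ kleinDisc)
    {v w : KPlane} (hvw : fderiv ℝ X x v = fderiv ℝ X x w) : v = w := by
  rw [h.fderiv_apply hx, h.fderiv_apply hx] at hvw
  have := fderiv_hypLift_injective hx hvw
  by_contra hne
  exact h.tensor_ne_zero hx (sub_ne_zero.2 hne) (by rw [map_sub, this, sub_self])

theorem fderiv_lift_injective (h : IsCodazziImmersion F b X) {x : KPlane} (hx : x ∈ kleinDisc)
    {v w : KPlane} (hvw : fderiv ℝ (fun y => hypLift (F y)) x v =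
      fderiv ℝ (fun y => hypLift (F y)) x w) : v = w := by
  rw [h.fderiv_lift hx, h.fderiv_lift hx] at hvw
  have := fderiv_hypLift_injective (h.mapsTo hx) hvw
  by_contra hne
  exact h.fderiv_ne_zero hx (sub_ne_zero.2 hne) (by rw [map_sub, this, sub_self])

theorem minkForm_fderiv_fderiv_normal {Q N : KPlane → KPlane × ℝ} (hQ : ContDiffOn ℝ ∞ Q kleinDisc)
    (hN : ContDiffOn ℝ ∞ N kleinDisc)
    (h : ∀ y ∈ kleinDisc, ∀ v, minkForm (fderiv ℝ Q y v) (N y) = 0) {x : KPlane}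
    (hx : x ∈ kleinDisc) (u v : KPlane) :
    minkForm (fderiv ℝ (fderiv ℝ Q) x u v) (N x) =
      -minkForm (fderiv ℝ Q x v) (fderiv ℝ N x u) := by
  have hQ1 := (hQ.fderiv_infty isOpen_kleinDisc).differentiableAt_of_isOpen isOpen_kleinDisc hx
  have hev : (fun y => minkForm (fderiv ℝ Q y v) (N y)) =ᶠ[nhds x] fun _ => (0 : ℝ) := by
    filter_upwards [isOpen_kleinDisc.mem_nhds hx] with y hy using h y hy v
  have e := congrArg (fun L : KPlane →L[ℝ] ℝ => L u) hev.fderiv_eq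
  rw [fderiv_minkForm (hasFDerivAt_fderiv_apply hQ1 v).differentiableAt
    (hN.differentiableAt_of_isOpen isOpen_kleinDisc hx), fderiv_clm_apply_const hQ1] at e
  simp at e
  linarith

/-- Gauss' formula for the immersion `X` and for the lift of `F` to the hyperboloid: the two
second derivatives have the same tangential part. -/
theorem exists_gauss_formula (h : IsCodazziImmersion F b X) {x : KPlane} (hx : x ∈ kleinDisc)
    (u v : KPlane) : ∃ c : KPlane,
      fderiv ℝ (fderiv ℝ X) x u v = fderiv ℝ X x c + kleinMetric x u (b x v) • hypLift x ∧
      fderiv ℝ (fderiv ℝ (fun y => hypLift (F y))) x u v =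
        fderiv ℝ (fun y => hypLift (F y)) x c + kleinMetric x (b x u) (b x v) • hypLift (F x) := by
  have n1 : minkForm (fderiv ℝ (fderiv ℝ X) x u v) (hypLift x) = -kleinMetric x u (b x v) := by
    rw [minkForm_fderiv_fderiv_normal h.contDiffOn contDiffOn_hypLift
      (fun y hy w => h.minkForm_fderiv_hypLift_eq_zero hy w) hx, h.fderiv_apply hx,
      minkForm_fderiv_hypLift hx, kleinMetric_symm]
  have n2 : minkForm (fderiv ℝ (fderiv ℝ (fun y => hypLift (F y))) x u v) (hypLift (F x)) =
      -kleinMetric x (b x u) (b x v) := by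
    rw [minkForm_fderiv_fderiv_normal h.contDiffOn_lift h.contDiffOn_lift
      (fun y hy w => h.minkForm_fderiv_lift_eq_zero hy w) hx, h.minkForm_fderiv_lift hx,
      kleinMetric_symm]
  obtain ⟨a, ha⟩ := exists_fderiv_hypLift_eq hx (p := fderiv ℝ (fderiv ℝ X) x u v -
    kleinMetric x u (b x v) • hypLift x) (by
      rw [minkForm_sub_left, minkForm_smul_left, n1, minkForm_hypLift_self hx]; ring)
  obtain ⟨c, rfl⟩ := surjective_of_forall_ne_zero (fun v hv => h.tensor_ne_zero hx hv) a
  obtain ⟨a', ha'⟩ := exists_fderiv_hypLift_eq (h.mapsTo hx)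
    (p := fderiv ℝ (fderiv ℝ (fun y => hypLift (F y))) x u v -
      kleinMetric x (b x u) (b x v) • hypLift (F x)) (by
      rw [minkForm_sub_left, minkForm_smul_left, n2, minkForm_hypLift_self (h.mapsTo hx)]; ring)
  obtain ⟨c', rfl⟩ := surjective_of_forall_ne_zero (fun v hv => h.fderiv_ne_zero hx hv) a'
  rw [← h.fderiv_apply hx, eq_sub_iff_add_eq] at ha
  rw [← h.fderiv_lift hx, eq_sub_iff_add_eq] at ha'
  refine ⟨c, ha.symm, ?_⟩
  -- Both tangential parts have the same products with all tangent vectors, and the induced metric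
  -- is positive definite, so their coordinates agree.
  suffices c = c' by rw [this]; exact ha'.symm
  have key : ∀ w, minkForm (fderiv ℝ X x (c - c')) (fderiv ℝ X x w) = 0 := by
    intro w
    have e := minkForm_fderiv_fderiv_eq isOpen_kleinDisc h.contDiffOn h.contDiffOn_lift
      (fun y hy v w => h.minkForm_fderiv_eq hy v w) hx u v w
    rw [← ha, ← ha', minkForm_add_left, minkForm_add_left, minkForm_smul_left, minkForm_smul_left,
      minkForm_comm (hypLift x), minkForm_comm (hypLift (F x)),
      h.minkForm_fderiv_hypLift_eq_zero hx, h.minkForm_fderiv_lift_eq_zero hx,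
      ← h.minkForm_fderiv_eq hx] at e
    rw [map_sub, minkForm_sub_left]
    linarith
  by_contra hne
  have h1 := key (c - c')
  rw [h.minkForm_fderiv hx] at h1
  exact (kleinMetric_pos hx (h.tensor_ne_zero hx (sub_ne_zero.2 hne))).ne' h1

/-- The immersion and the lift of `F` have the same intrinsic curvature. Once the common tangential
parts cancel, Gauss' equation equates the determinants of the two second fundamental forms h(·, b·)
and h(b·, b·), which are `lorentzFactor x ^ 6` times det b and (det b)². As b is invertible, det b =
1. -/
theorem det_tensor (h : IsCodazziImmersion F b X) {x : KPlane} (hx : x ∈ kleinDisc) :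
    (b x).det = 1 := by
  set u : KPlane := EuclideanSpace.single 0 1
  set v : KPlane := EuclideanSpace.single 1 1
  have G := minkForm_gauss_eq isOpen_kleinDisc h.contDiffOn h.contDiffOn_lift
      (fun y hy v w => h.minkForm_fderiv_eq hy v w) hx u v
  have gen : ∀ u v u' v' : KPlane,
      minkForm (fderiv ℝ (fderiv ℝ X) x u v) (fderiv ℝ (fderiv ℝ X) x u' v') +
        kleinMetric x u (b x v) * kleinMetric x u' (b x v') =
      minkForm (fderiv ℝ (fderiv ℝ (fun y => hypLift (F y))) x u v)
        (fderiv ℝ (fderiv ℝ (fun y => hypLift (F y))) x u' v') +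
        kleinMetric x (b x u) (b x v) * kleinMetric x (b x u') (b x v') := by
    intro u v u' v'
    obtain ⟨c, h1, h2⟩ := h.exists_gauss_formula hx u v
    obtain ⟨c', h1', h2'⟩ := h.exists_gauss_formula hx u' v'
    rw [h1, h2, h1', h2']
    simp only [minkForm_add_left, minkForm_add_right, minkForm_smul_left, minkForm_smul_right,
      h.minkForm_fderiv_hypLift_eq_zero hx, h.minkForm_fderiv_lift_eq_zero hx,
      minkForm_comm (hypLift x) (fderiv ℝ X x _),
      minkForm_comm (hypLift (F x)) (fderiv ℝ (fun y => hypLift (F y)) x _),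
      minkForm_hypLift_self hx, minkForm_hypLift_self (h.mapsTo hx), h.minkForm_fderiv_eq hx]
    ring
  have g1 := gen u u v v
  have g2 := gen u v u v
  have k1 := kleinMetric_gram hx u v (b x u) (b x v)
  have k2 := kleinMetric_gram hx (b x u) (b x v) (b x u) (b x v)
  have hs : kleinMetric x v (b x u) = kleinMetric x u (b x v) := by
    rw [← h.symm x hx, kleinMetric_symm]
  rw [hs, wedge_single, ← det_eq_wedge] at k1
  rw [← det_eq_wedge, kleinMetric_symm x (b x v) (b x u)] at k2
  have hk := pow_pos (lorentzFactor_pos hx) 6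
  have hd0 : (b x).det ≠ 0 := by
    intro h0
    have hinj : Function.Injective (b x) := (injective_iff_map_eq_zero _).2 fun w hw => by
      by_contra hne
      exact h.tensor_ne_zero hx hne hw
    exact (LinearMap.bot_lt_ker_of_det_eq_zero h0).ne' (LinearMap.ker_eq_bot.2 hinj)
  have e : lorentzFactor x ^ 6 * (b x).det * ((b x).det - 1) = 0 := by
    linear_combination G - g1 + g2 + k1 - k2
  rcases mul_eq_zero.1 e with e | e
  · exact absurd e (mul_ne_zero hk.ne' hd0)
  · linarith

end IsCodazziImmersion

/-! ### Monotonicity and Jacobian of the horizontal projection. -/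

/-- Tangent vectors of the hyperboloid at `hypLift x` are Minkowski-orthogonal to (x, 1), hence
determined by their horizontal part. -/
theorem fderiv_hypLift_snd {x : KPlane} (hx : x ∈ kleinDisc) (a : KPlane) :
    (fderiv ℝ hypLift x a).2 = inner ℝ x (fderiv ℝ hypLift x a).1 := by
  rw [fderiv_hypLift hx]
  simp only [Prod.snd_add, Prod.smul_snd, Prod.fst_add, Prod.smul_fst, inner_add_right,
    real_inner_smul_right, real_inner_self_eq_norm_sq, smul_eq_mul]
  linear_combination lorentzFactor x * inner ℝ x a * lorentzFactor_sq_mul hx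

/-- This turns positivity of `b` for the hyperbolic metric into positivity of the horizontal
differential for the Euclidean inner product. -/
theorem inner_fderiv_hypLift {x : KPlane} (hx : x ∈ kleinDisc) (a w : KPlane) :
    lorentzFactor x * inner ℝ (fderiv ℝ hypLift x a).1 w = kleinMetric x a w := by
  rw [fderiv_hypLift hx, kleinMetric_eq hx]
  simp only [Prod.fst_add, Prod.smul_fst, inner_add_left, real_inner_smul_left]
  ring

theorem minkForm_eq_of_snd {x : KPlane} {p q : KPlane × ℝ} (hp : p.2 = inner ℝ x p.1)
    (hq : q.2 = inner ℝ x q.1) :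
    minkForm p q = inner ℝ p.1 q.1 - inner ℝ x p.1 * inner ℝ x q.1 := by
  rw [minkForm, hp, hq]

/-- The mean value theorem for `⟪f x - f z, x - z⟫` on a convex set. -/
theorem exists_inner_sub_eq {f : KPlane → KPlane} {f' : KPlane → KPlane →L[ℝ] KPlane}
    {s : Set KPlane} (hs : Convex ℝ s) (hf : ∀ x ∈ s, HasFDerivAt f (f' x) x) {x z : KPlane}
    (hx : x ∈ s) (hz : z ∈ s) :
    ∃ y ∈ s, inner ℝ (f x - f z) (x - z) = inner ℝ (f' y (x - z)) (x - z) := by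
  have hmem : ∀ t ∈ Icc (0 : ℝ) 1, z + t • (x - z) ∈ s := fun t ht =>
    hs.add_smul_sub_mem hz hx ht
  have hd : ∀ t ∈ Icc (0 : ℝ) 1, HasDerivAt (fun t : ℝ => (inner ℝ (f (z + t • (x - z))) (x - z) : ℝ))
      (inner ℝ (f' (z + t • (x - z)) (x - z)) (x - z)) t := by
    intro t ht
    have hγ : HasDerivAt (fun t : ℝ => z + t • (x - z)) (x - z) t := by
      simpa using ((hasDerivAt_id t).smul_const (x - z)).const_add z
    simpa using ((hf _ (hmem t ht)).comp_hasDerivAt t hγ).inner ℝ (hasDerivAt_const t (x - z))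
  obtain ⟨t, ht, h⟩ := exists_hasDerivAt_eq_slope _ _ (zero_lt_one' ℝ)
    (fun t ht => (hd t ht).continuousAt.continuousWithinAt)
    (fun t ht => hd t (Ioo_subset_Icc_self ht))
  refine ⟨_, hmem t (Ioo_subset_Icc_self ht), ?_⟩
  rw [h, inner_sub_left]
  simp

namespace IsCodazziImmersion

variable {F : KPlane → KPlane} {b : KPlane → KPlane →L[ℝ] KPlane} {X : KPlane → KPlane × ℝ}

theorem hasFDerivAt_fst (h : IsCodazziImmersion F b X) {x : KPlane} (hx : x ∈ kleinDisc) :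
    HasFDerivAt (fun y => (X y).1) ((ContinuousLinearMap.fst ℝ KPlane ℝ).comp (fderiv ℝ X x)) x :=
  (h.contDiffOn.differentiableAt_of_isOpen isOpen_kleinDisc hx).hasFDerivAt.fst

theorem hasFDerivAt_snd (h : IsCodazziImmersion F b X) {x : KPlane} (hx : x ∈ kleinDisc) :
    HasFDerivAt (fun y => (X y).2) ((ContinuousLinearMap.snd ℝ KPlane ℝ).comp (fderiv ℝ X x)) x :=
  (h.contDiffOn.differentiableAt_of_isOpen isOpen_kleinDisc hx).hasFDerivAt.snd

theorem continuousOn_fst (h : IsCodazziImmersion F b X) :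
    ContinuousOn (fun y => (X y).1) kleinDisc :=
  fun _ hx => (h.hasFDerivAt_fst hx).continuousAt.continuousWithinAt

theorem continuousOn_snd (h : IsCodazziImmersion F b X) :
    ContinuousOn (fun y => (X y).2) kleinDisc :=
  fun _ hx => (h.hasFDerivAt_snd hx).continuousAt.continuousWithinAt

theorem fderiv_snd (h : IsCodazziImmersion F b X) {x : KPlane} (hx : x ∈ kleinDisc) (v : KPlane) :
    (fderiv ℝ X x v).2 = inner ℝ x (fderiv ℝ X x v).1 := by
  rw [h.fderiv_apply hx, fderiv_hypLift_snd hx]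

theorem inner_fderiv_fst_pos (h : IsCodazziImmersion F b X) {x : KPlane} (hx : x ∈ kleinDisc)
    {v : KPlane} (hv : v ≠ 0) : 0 < inner ℝ (fderiv ℝ X x v).1 v := by
  have h1 := h.pos x hx v hv
  rw [← inner_fderiv_hypLift hx, ← h.fderiv_apply hx] at h1
  exact pos_of_mul_pos_right h1 (lorentzFactor_pos hx).le

/-- As det b = 1, the Gram determinant of F^*h is `lorentzFactor x ^ 6`; projecting the tangent
plane orthogonal to (x, 1) horizontally multiplies the squared area by one more `lorentzFactor x ^
2`. -/
theorem abs_det_fderiv_fst (h : IsCodazziImmersion F b X) {x : KPlane} (hx : x ∈ kleinDisc) :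
    |((ContinuousLinearMap.fst ℝ KPlane ℝ).comp (fderiv ℝ X x)).det| = lorentzFactor x ^ 4 := by
  set L := (ContinuousLinearMap.fst ℝ KPlane ℝ).comp (fderiv ℝ X x) with hL
  set u : KPlane := EuclideanSpace.single 0 1
  set v : KPlane := EuclideanSpace.single 1 1
  have hm : ∀ u v : KPlane, inner ℝ (L u) (L v) - inner ℝ x (L u) * inner ℝ x (L v) =
      kleinMetric x (b x u) (b x v) := by
    intro u v
    rw [← h.minkForm_fderiv hx, minkForm_eq_of_snd (h.fderiv_snd hx u) (h.fderiv_snd hx v)]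
    rfl
  have h1 := minkForm_orthogonal_gram x (L u) (L v)
  rw [hm, hm, hm, sq, kleinMetric_symm x (b x u) (b x v)] at h1
  nth_rewrite 1 [kleinMetric_symm x (b x v) (b x u)] at h1
  rw [kleinMetric_gram hx, ← det_eq_wedge, ← det_eq_wedge, h.det_tensor hx] at h1
  have hk := lorentzFactor_sq_mul hx
  have h2 : L.det ^ 2 = (lorentzFactor x ^ 4) ^ 2 := by
    linear_combination -lorentzFactor x ^ 2 * h1 - L.det ^ 2 * hk
  rw [← abs_of_nonneg (pow_nonneg (lorentzFactor_pos hx).le 4)]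
  exact (sq_eq_sq_iff_abs_eq_abs _ _).1 h2

theorem inner_fst_sub_pos (h : IsCodazziImmersion F b X) {x z : KPlane} (hx : x ∈ kleinDisc)
    (hz : z ∈ kleinDisc) (hne : x ≠ z) : 0 < inner ℝ ((X x).1 - (X z).1) (x - z) := by
  obtain ⟨y, hy, e⟩ := exists_inner_sub_eq convex_kleinDisc (fun y hy => h.hasFDerivAt_fst hy) hx hz
  rw [e]
  exact h.inner_fderiv_fst_pos hy (sub_ne_zero.2 hne)

theorem inner_fst_sub_nonneg (h : IsCodazziImmersion F b X) {x z : KPlane} (hx : x ∈ kleinDisc)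
    (hz : z ∈ kleinDisc) : 0 ≤ inner ℝ ((X x).1 - (X z).1) (x - z) := by
  rcases eq_or_ne x z with rfl | hne
  · simp
  · exact (h.inner_fst_sub_pos hx hz hne).le

theorem injOn_fst (h : IsCodazziImmersion F b X) : InjOn (fun y => (X y).1) kleinDisc := by
  intro x hx z hz hxz
  by_contra hne
  have := h.inner_fst_sub_pos hx hz hne
  simp only at hxz
  rw [hxz] at this
  simp at this

/-- Convexity of the surface: it lies above its tangent plane at `z`, whose slope is `z`. On the
segment from `z` to `x`, at the point y, the difference of height and affine function has derivative
⟪y - z, dX.1(x - z)⟫, which is nonnegative by monotonicity. -/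
theorem inner_fst_sub_le_snd_sub (h : IsCodazziImmersion F b X) {x z : KPlane}
    (hx : x ∈ kleinDisc) (hz : z ∈ kleinDisc) :
    inner ℝ ((X x).1 - (X z).1) z ≤ (X x).2 - (X z).2 := by
  have hmem : ∀ t ∈ Icc (0 : ℝ) 1, z + t • (x - z) ∈ kleinDisc := fun t ht =>
    convex_kleinDisc.add_smul_sub_mem hz hx ht
  have hd : ∀ t ∈ Icc (0 : ℝ) 1,
      HasDerivAt (fun t : ℝ => (X (z + t • (x - z))).2 - (inner ℝ (X (z + t • (x - z))).1 z : ℝ))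
      ((fderiv ℝ X (z + t • (x - z)) (x - z)).2 -
        inner ℝ (fderiv ℝ X (z + t • (x - z)) (x - z)).1 z) t := by
    intro t ht
    have hγ : HasDerivAt (fun t : ℝ => z + t • (x - z)) (x - z) t := by
      simpa using ((hasDerivAt_id t).smul_const (x - z)).const_add z
    refine ((h.hasFDerivAt_snd (hmem t ht)).comp_hasDerivAt t hγ).sub ?_
    simpa using ((h.hasFDerivAt_fst (hmem t ht)).comp_hasDerivAt t hγ).inner ℝ
      (hasDerivAt_const t z)
  obtain ⟨t, ht, e⟩ := exists_hasDerivAt_eq_slope _ _ (zero_lt_one' ℝ)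
    (fun t ht => (hd t ht).continuousAt.continuousWithinAt)
    (fun t ht => hd t (Ioo_subset_Icc_self ht))
  have hy := hmem t (Ioo_subset_Icc_self ht)
  rw [h.fderiv_snd hy, real_inner_comm, ← inner_sub_right, add_sub_cancel_left,
    real_inner_smul_right] at e
  have hnn : 0 ≤ t * inner ℝ (fderiv ℝ X (z + t • (x - z)) (x - z)).1 (x - z) := by
    refine mul_nonneg ht.1.le ?_
    rcases eq_or_ne (x - z) 0 with h0 | h0
    · simp [h0]
    · exact (h.inner_fderiv_fst_pos hy h0).le
  rw [e] at hnn
  simp only [one_smul, zero_smul, add_zero, add_sub_cancel, sub_zero, div_one] at hnn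
  rw [inner_sub_left]
  linarith

end IsCodazziImmersion

/-! ### Properness of the height function. -/

theorem closedBall_half_subset_kleinDisc : Metric.closedBall (0 : KPlane) (1 / 2) ⊆ kleinDisc :=
  Metric.closedBall_subset_ball (by norm_num)

theorem exists_norm_le_inner_eq (w : KPlane) {r : ℝ} (hr : 0 ≤ r) :
    ∃ e : KPlane, ‖e‖ ≤ r ∧ inner ℝ w e = r * ‖w‖ := by
  rcases eq_or_ne w 0 with rfl | hw
  · exact ⟨0, by simpa using hr, by simp⟩
  · have hn := norm_pos_iff.2 hw
    refine ⟨(r / ‖w‖) • w, ?_, ?_⟩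
    · rw [norm_smul, Real.norm_of_nonneg (by positivity), div_mul_cancel₀ _ hn.ne']
    · rw [real_inner_smul_right, real_inner_self_eq_norm_sq]
      field_simp

namespace IsCodazziImmersion

variable {F : KPlane → KPlane} {b : KPlane → KPlane →L[ℝ] KPlane} {X : KPlane → KPlane × ℝ}

theorem exists_norm_fst_le (h : IsCodazziImmersion F b X) :
    ∃ M : ℝ, ∀ z : KPlane, ‖z‖ ≤ 1 / 2 → ‖(X z).1‖ ≤ M := by
  obtain ⟨M, hM⟩ := (isCompact_closedBall (0 : KPlane) (1 / 2)).exists_bound_of_continuousOn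
    (h.continuousOn_fst.mono closedBall_half_subset_kleinDisc)
  exact ⟨M, fun z hz => hM z (by simpa using hz)⟩

/-- If the first component stays bounded along a sequence converging to the boundary point `x₀`,
then it is bounded on a cone with vertex `x₀`. -/
theorem exists_norm_fst_le_cone (h : IsCodazziImmersion F b X) {x₀ : KPlane} (hx₀ : ‖x₀‖ = 1)
    {R : ℝ} (hR : ∀ x ∈ kleinDisc, inner ℝ (X x).1 (x₀ - x) ≤ R * ‖x₀ - x‖) :
    ∃ C : ℝ, ∀ t ∈ Ioo (0 : ℝ) 1, ∀ z₀ : KPlane, ‖z₀‖ ≤ 1 / 4 →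
      ‖(X ((1 - t) • x₀ + t • z₀)).1‖ ≤ C := by
  obtain ⟨M, hM⟩ := h.exists_norm_fst_le
  refine ⟨4 * (2 * M + 2 * |R|), fun t ht z₀ hz₀ => ?_⟩
  set x := (1 - t) • x₀ + t • z₀ with hx
  have hxn : ‖x‖ ≤ (1 - t) * 1 + t * (1 / 4) := by
    refine (norm_add_le _ _).trans ?_
    rw [norm_smul, norm_smul, Real.norm_of_nonneg ht.1.le, Real.norm_of_nonneg (by linarith [ht.2]),
      hx₀]
    gcongr
    exact ht.1.le
  have hxD : x ∈ kleinDisc := mem_kleinDisc.2 (by linarith [ht.1])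
  -- Monotonicity is tested between `x` and `z₀ + e`, with `e` pointing along `(X x).1` so that the
  -- pairing produces ‖(X x).1‖ / 4. The radii 1/4 + 1/4 keep `z₀ + e` in the ball where `M` is a
  -- bound.
  obtain ⟨e, he, hie⟩ := exists_norm_le_inner_eq (X x).1 (r := 1 / 4) (by norm_num)
  have hz : ‖z₀ + e‖ ≤ 1 / 2 := (norm_add_le _ _).trans (by linarith)
  have hzD : z₀ + e ∈ kleinDisc := mem_kleinDisc.2 (by linarith)
  have hmono := h.inner_fst_sub_nonneg hxD hzD
  have hzb : inner ℝ (X (z₀ + e)).1 (z₀ + e - x) ≤ M * 2 := by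
    refine (real_inner_le_norm _ _).trans ?_
    have h1 := hM _ hz
    have h2 : ‖z₀ + e - x‖ ≤ 2 := (norm_sub_le _ _).trans (by
      have := mem_kleinDisc.1 hxD
      linarith)
    exact mul_le_mul h1 h2 (norm_nonneg _) ((norm_nonneg _).trans h1)
  have e1 : x₀ - x = t • (x₀ - z₀) := by rw [hx]; module
  have e2 : z₀ + e - x = e - (1 - t) • (x₀ - z₀) := by rw [hx]; module
  have hR1 := hR x hxD
  rw [e1, real_inner_smul_right, norm_smul, Real.norm_of_nonneg ht.1.le] at hR1
  have hR2 : inner ℝ (X x).1 (x₀ - z₀) ≤ R * ‖x₀ - z₀‖ := by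
    refine le_of_mul_le_mul_left ?_ ht.1
    linarith
  have hR3 : inner ℝ (X x).1 (x₀ - z₀) ≤ 2 * |R| := by
    have h2 : ‖x₀ - z₀‖ ≤ 2 := (norm_sub_le _ _).trans (by linarith)
    refine hR2.trans ((mul_le_mul_of_nonneg_right (le_abs_self R) (norm_nonneg _)).trans ?_)
    nlinarith [abs_nonneg R]
  have e3 : inner ℝ ((X x).1 - (X (z₀ + e)).1) (x - (z₀ + e)) =
      inner ℝ (X (z₀ + e)).1 (z₀ + e - x) - inner ℝ (X x).1 (z₀ + e - x) := by
    rw [← neg_sub (z₀ + e) x, inner_neg_right, inner_sub_left]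
    ring
  rw [e3] at hmono
  have e4 : inner ℝ (X x).1 (z₀ + e - x) = 1 / 4 * ‖(X x).1‖ -
      (1 - t) * inner ℝ (X x).1 (x₀ - z₀) := by
    rw [e2, inner_sub_right, hie, real_inner_smul_right]
  have h5 : (1 - t) * inner ℝ (X x).1 (x₀ - z₀) ≤ 2 * |R| := by
    have := mul_le_mul_of_nonneg_left hR3 (by linarith [ht.2] : (0 : ℝ) ≤ 1 - t)
    nlinarith [abs_nonneg R, ht.1]
  linarith

open MeasureTheory in
/-- The image of a cone with vertex on the boundary has infinite area. -/
theorem not_bounded_fst_cone (h : IsCodazziImmersion F b X) {x₀ : KPlane} (hx₀ : ‖x₀‖ = 1) (C : ℝ)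
    (hC : ∀ t ∈ Ioo (0 : ℝ) 1, ∀ z₀ : KPlane, ‖z₀‖ ≤ 1 / 4 →
      ‖(X ((1 - t) • x₀ + t • z₀)).1‖ ≤ C) : False := by
  -- The balls of radius t/4 about (1 - t)x₀ lie in the cone, and the ratio 1/4 between consecutive
  -- scales makes them disjoint. On each ball 1 - |x|² ≤ 4t, so the Jacobian is at least 1/(16t²);
  -- against the factor t²/16 in the area this leaves 1/256 of the unit disc, at every scale.
  set t : ℕ → ℝ := fun k => (1 / 4) ^ (k + 1) with ht
  have ht0 : ∀ k, 0 < t k := fun k => by positivity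
  have ht1 : ∀ k, t k < 1 := fun k => pow_lt_one₀ (by norm_num) (by norm_num) (by simp)
  set B : ℕ → Set KPlane := fun k => Metric.ball ((1 - t k) • x₀) (t k / 4) with hB
  have hnc : ∀ k, ‖(1 - t k) • x₀‖ = 1 - t k := fun k => by
    rw [norm_smul, hx₀, Real.norm_of_nonneg (by linarith [ht1 k]), mul_one]
  have hup : ∀ k, ∀ x ∈ B k, ‖x‖ < 1 - t k + t k / 4 := by
    intro k x hx
    have h1 : ‖x - (1 - t k) • x₀‖ < t k / 4 := by simpa [hB, dist_eq_norm] using hx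
    have h2 := norm_add_le (x - (1 - t k) • x₀) ((1 - t k) • x₀)
    rw [sub_add_cancel, hnc] at h2
    linarith
  have hlow : ∀ k, ∀ x ∈ B k, 1 - t k - t k / 4 < ‖x‖ := by
    intro k x hx
    have h1 : ‖x - (1 - t k) • x₀‖ < t k / 4 := by simpa [hB, dist_eq_norm] using hx
    have h2 := norm_sub_norm_le ((1 - t k) • x₀) x
    rw [norm_sub_rev, hnc] at h2
    linarith
  have hsub : ∀ k, B k ⊆ kleinDisc := fun k x hx =>
    mem_kleinDisc.2 ((hup k x hx).trans (by linarith [ht0 k]))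
  have hdisj : Pairwise (Function.onFun Disjoint B) := by
    rw [pairwise_disjoint_on]
    intro k l hkl
    refine Set.disjoint_left.2 fun x hk hl => ?_
    have h1 := hup k x hk
    have h2 := hlow l x hl
    have h3 : t l ≤ t k * (1 / 4) := by
      have : t l ≤ t (k + 1) :=
        pow_le_pow_of_le_one (by norm_num) (by norm_num) (by omega)
      rwa [show t (k + 1) = t k * (1 / 4) from pow_succ _ _] at this
    have := ht0 k
    linarith
  set c : ENNReal := ENNReal.ofReal (1 / 256) * volume (Metric.ball (0 : KPlane) 1) with hc
  have hc0 : c ≠ 0 := by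
    have := Metric.measure_ball_pos volume (0 : KPlane) one_pos
    rw [hc]
    exact mul_ne_zero (by norm_num) this.ne'
  have hvol : ∀ k, c ≤ ∫⁻ x in B k, ENNReal.ofReal
      |((ContinuousLinearMap.fst ℝ KPlane ℝ).comp (fderiv ℝ X x)).det| := by
    intro k
    have h1 : ∀ x ∈ B k, ENNReal.ofReal (1 / (16 * t k ^ 2)) ≤ ENNReal.ofReal
        |((ContinuousLinearMap.fst ℝ KPlane ℝ).comp (fderiv ℝ X x)).det| := by
      intro x hx
      refine ENNReal.ofReal_le_ofReal ?_
      rw [h.abs_det_fderiv_fst (hsub k hx), show lorentzFactor x ^ 4 = (lorentzFactor x ^ 2) ^ 2 by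
        ring, lorentzFactor_sq (hsub k hx), inv_pow, one_div]
      have hpos := one_sub_norm_sq_pos (hsub k hx)
      have h2 := hlow k x hx
      have h3 : 1 - ‖x‖ ^ 2 ≤ 4 * t k := by
        have := mem_kleinDisc.1 (hsub k hx)
        have := ht0 k
        nlinarith [norm_nonneg x]
      rw [show 16 * t k ^ 2 = (4 * t k) ^ 2 by ring]
      gcongr
    refine le_trans (le_of_eq ?_) (setLIntegral_mono' measurableSet_ball h1)
    rw [setLIntegral_const, hB, Measure.addHaar_ball _ _ (by linarith [ht0 k]), finrank_euclideanSpace,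
      Fintype.card_fin, ← mul_assoc, ← ENNReal.ofReal_mul (by have := ht0 k; positivity), hc]
    congr 2
    have := ht0 k
    field_simp
    norm_num
  have hSm : MeasurableSet (⋃ k, B k) := MeasurableSet.iUnion fun k => measurableSet_ball
  have harea := lintegral_abs_det_fderiv_eq_addHaar_image volume hSm
    (f := fun y => (X y).1)
    (fun x hx => (h.hasFDerivAt_fst (iUnion_subset hsub hx)).hasFDerivWithinAt)
    (h.injOn_fst.mono (iUnion_subset hsub))
  rw [lintegral_iUnion (fun k => measurableSet_ball) hdisj] at harea
  have htop : ∑' k, ∫⁻ x in B k, ENNReal.ofReal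
      |((ContinuousLinearMap.fst ℝ KPlane ℝ).comp (fderiv ℝ X x)).det| = ⊤ := by
    refine top_le_iff.1 ?_
    rw [← ENNReal.tsum_const_eq_top_of_ne_zero (α := ℕ) hc0]
    exact ENNReal.tsum_le_tsum hvol
  have hbd : (fun y => (X y).1) '' (⋃ k, B k) ⊆ Metric.closedBall 0 C := by
    rintro _ ⟨x, hx, rfl⟩
    obtain ⟨k, hk⟩ := mem_iUnion.1 hx
    have h0 := ht0 k
    have h1 : ‖x - (1 - t k) • x₀‖ < t k / 4 := by simpa [hB, dist_eq_norm] using hk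
    have h2 := hC (t k) ⟨h0, ht1 k⟩ ((t k)⁻¹ • (x - (1 - t k) • x₀)) (by
      rw [norm_smul, norm_inv, Real.norm_of_nonneg h0.le, inv_mul_le_iff₀ h0]
      linarith)
    rw [smul_smul, mul_inv_cancel₀ h0.ne', one_smul, add_sub_cancel] at h2
    simpa using h2
  have := (measure_mono (μ := volume) hbd).trans_lt measure_closedBall_lt_top
  rw [← harea, htop] at this
  exact lt_irrefl _ this

/-- Otherwise points with bounded horizontal part accumulate at some `x₀` on the circle.
Monotonicity against each fixed `x` passes to the limit and gives the hypothesis of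
`exists_norm_fst_le_cone`, whose conclusion contradicts the infinite area of a cone. -/
theorem exists_norm_lt_of_norm_fst_le (h : IsCodazziImmersion F b X) (R : ℝ) :
    ∃ r < 1, ∀ x ∈ kleinDisc, ‖(X x).1‖ ≤ R → ‖x‖ ≤ r := by
  by_contra! hcon
  have hseq : ∀ n : ℕ, ∃ x ∈ kleinDisc, ‖(X x).1‖ ≤ R ∧ 1 - 1 / ((n : ℝ) + 1) < ‖x‖ := fun n =>
    hcon (1 - 1 / ((n : ℝ) + 1)) (by
      have : (0 : ℝ) < 1 / ((n : ℝ) + 1) := by positivity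
      linarith)
  choose u huD huR hun using hseq
  obtain ⟨x₀, -, φ, hφ, hlim⟩ := (isCompact_closedBall (0 : KPlane) 1).tendsto_subseq
    (fun n => by simpa using (mem_kleinDisc.1 (huD n)).le)
  have hx₀ : ‖x₀‖ = 1 := by
    have h1 : Filter.Tendsto (fun n => ‖u n‖) Filter.atTop (nhds 1) := by
      refine tendsto_of_tendsto_of_tendsto_of_le_of_le ?_ tendsto_const_nhds (fun n => (hun n).le)
        (fun n => (mem_kleinDisc.1 (huD n)).le)
      simpa using tendsto_const_nhds.sub (tendsto_one_div_add_atTop_nhds_zero_nat (𝕜 := ℝ))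
    exact tendsto_nhds_unique hlim.norm (h1.comp hφ.tendsto_atTop)
  have hR : ∀ x ∈ kleinDisc, inner ℝ (X x).1 (x₀ - x) ≤ R * ‖x₀ - x‖ := by
    intro x hx
    refine le_of_tendsto_of_tendsto' ((tendsto_const_nhds.inner (hlim.sub_const x)))
      ((hlim.sub_const x).norm.const_mul R) fun n => ?_
    have h1 := h.inner_fst_sub_nonneg hx (huD (φ n))
    rw [← neg_sub (u (φ n)) x, inner_neg_right, inner_sub_left] at h1
    have h2 := real_inner_le_norm (X (u (φ n))).1 (u (φ n) - x)
    have h3 := mul_le_mul_of_nonneg_right (huR (φ n)) (norm_nonneg (u (φ n) - x))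
    simp only [Function.comp_apply]
    linarith
  obtain ⟨C, hC⟩ := h.exists_norm_fst_le_cone hx₀ hR
  exact h.not_bounded_fst_cone hx₀ C hC

/-- The height function of the immersion is proper. -/
theorem exists_norm_lt_of_snd_le (h : IsCodazziImmersion F b X) (c : ℝ) :
    ∃ r < 1, ∀ x ∈ kleinDisc, (X x).2 ≤ c → ‖x‖ ≤ r := by
  obtain ⟨M, hM⟩ := h.exists_norm_fst_le
  obtain ⟨M', hM'⟩ := (isCompact_closedBall (0 : KPlane) (1 / 2)).exists_bound_of_continuousOn
    (h.continuousOn_snd.mono closedBall_half_subset_kleinDisc)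
  obtain ⟨r, hr, hr'⟩ := h.exists_norm_lt_of_norm_fst_le (2 * (c + M' + M * (1 / 2)))
  refine ⟨r, hr, fun x hx hxc => hr' x hx ?_⟩
  -- The tangent plane at a point `e` of length at most 1/2 along `(X x).1` shows that the height
  -- grows at least like half the horizontal norm, up to a constant.
  obtain ⟨e, he, hie⟩ := exists_norm_le_inner_eq (X x).1 (r := 1 / 2) (by norm_num)
  have heD : e ∈ kleinDisc := mem_kleinDisc.2 (by linarith)
  have h1 := h.inner_fst_sub_le_snd_sub hx heD
  rw [inner_sub_left, hie] at h1
  have h2 := neg_le_of_abs_le (hM' e (by simpa using he))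
  have h3 : inner ℝ (X e).1 e ≤ M * (1 / 2) := by
    refine (real_inner_le_norm _ _).trans ?_
    have := hM e he
    exact mul_le_mul this he (norm_nonneg _) ((norm_nonneg _).trans this)
  linarith

end IsCodazziImmersion

/-! ### Lifting segments through a local homeomorphism. -/

section SegmentLift

open Filter Topology

variable {E : Type*} [NormedAddCommGroup E] [NormedSpace ℝ E] {f : E → E} {s : Set E}

set_option linter.unusedSectionVars false

/-- `f` is a local homeomorphism at every point of `s`, with local inverses into `s`. -/
def IsLocalHomeoWithin (f : E → E) (s : Set E) : Prop :=
  ∀ x ∈ s, ∃ e : OpenPartialHomeomorph E E, x ∈ e.source ∧ e.source ⊆ s ∧ EqOn f e e.source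

/-- `σ` lifts the segment from `f x` to `η` to a path in `s` which starts at `x`. -/
structure IsSegmentLift (f : E → E) (s : Set E) (x η : E) (σ : ℝ → E) : Prop where
  zero : σ 0 = x
  continuousOn : ContinuousOn σ (Icc 0 1)
  mapsTo : MapsTo σ (Icc 0 1) s
  eq : ∀ t ∈ Icc (0 : ℝ) 1, f (σ t) = f x + t • (η - f x)

theorem IsLocalHomeoWithin.continuousAt (hf : IsLocalHomeoWithin f s) {x : E} (hx : x ∈ s) :
    ContinuousAt f x := by
  obtain ⟨e, hxe, -, he⟩ := hf x hx
  exact (e.continuousAt hxe).congr (he.eventuallyEq_of_mem (e.open_source.mem_nhds hxe)).symm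

theorem IsLocalHomeoWithin.exists_injOn (hf : IsLocalHomeoWithin f s) {x : E} (hx : x ∈ s) :
    ∃ u ∈ 𝓝 x, InjOn f u := by
  obtain ⟨e, hxe, -, he⟩ := hf x hx
  exact ⟨e.source, e.open_source.mem_nhds hxe, he.symm.injOn_iff.1 e.injOn⟩

theorem IsLocalHomeoWithin.isOpen_image (hf : IsLocalHomeoWithin f s) {N : Set E} (hN : IsOpen N)
    (hNs : N ⊆ s) : IsOpen (f '' N) := by
  rw [isOpen_iff_mem_nhds]
  rintro _ ⟨x, hx, rfl⟩
  obtain ⟨e, hxe, -, he⟩ := hf x (hNs hx)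
  have h1 : e '' (e.source ∩ N) ∈ 𝓝 (e x) :=
    (e.isOpen_image_source_inter hN).mem_nhds ⟨x, ⟨hxe, hx⟩, rfl⟩
  rw [he hxe]
  refine mem_of_superset h1 ?_
  rintro _ ⟨y, hy, rfl⟩
  exact ⟨y, hy.2, he hy.1⟩

/-- Uniqueness of lifts through a local homeomorphism. -/
theorem IsLocalHomeoWithin.eqOn_of_isPreconnected (hf : IsLocalHomeoWithin f s) {T : Set ℝ}
    (hT : IsPreconnected T) {σ τ : ℝ → E} (hσ : ContinuousOn σ T) (hτ : ContinuousOn τ T)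
    (hσs : MapsTo σ T s) (h : ∀ t ∈ T, f (σ t) = f (τ t)) {t₀ : ℝ} (ht₀ : t₀ ∈ T)
    (h₀ : σ t₀ = τ t₀) : EqOn σ τ T := by
  have : PreconnectedSpace T := isPreconnected_iff_preconnectedSpace.1 hT
  have hσ' := continuousOn_iff_continuous_domRestrict.1 hσ
  have hτ' := continuousOn_iff_continuous_domRestrict.1 hτ
  have hclopen : IsClopen {t : T | T.domRestrict σ t = T.domRestrict τ t} := by
    refine ⟨isClosed_eq hσ' hτ', isOpen_iff_mem_nhds.2 fun t ht => ?_⟩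
    obtain ⟨u, hu, hinj⟩ := hf.exists_injOn (hσs t.2)
    have h1 := hσ'.continuousAt.preimage_mem_nhds (x := t) hu
    have h2 := hτ'.continuousAt.preimage_mem_nhds (x := t) (t := u) (by
      rw [← show T.domRestrict σ t = T.domRestrict τ t from ht]; exact hu)
    filter_upwards [h1, h2] with r hr1 hr2 using hinj hr1 hr2 (h r r.2)
  have huniv := hclopen.eq_univ ⟨⟨t₀, ht₀⟩, h₀⟩
  intro t ht
  have : (⟨t, ht⟩ : T) ∈ {t : T | T.domRestrict σ t = T.domRestrict τ t} := huniv ▸ mem_univ _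
  exact this

theorem IsSegmentLift.map_one {x η : E} {σ : ℝ → E} (h : IsSegmentLift f s x η σ) : f (σ 1) = η := by
  rw [h.eq 1 (right_mem_Icc.2 zero_le_one), one_smul, add_sub_cancel]

theorem IsSegmentLift.eqOn_const (hf : IsLocalHomeoWithin f s) {x : E} {σ : ℝ → E}
    (h : IsSegmentLift f s x (f x) σ) : EqOn σ (fun _ => x) (Icc 0 1) :=
  hf.eqOn_of_isPreconnected isPreconnected_Icc h.continuousOn continuousOn_const h.mapsTo
    (fun t ht => by rw [h.eq t ht]; simp) (left_mem_Icc.2 zero_le_one) h.zero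

theorem IsSegmentLift.injOn_image (hf : IsLocalHomeoWithin f s) {x η : E} {σ : ℝ → E}
    (h : IsSegmentLift f s x η σ) : InjOn f (σ '' Icc 0 1) := by
  by_cases hη : η = f x
  · rw [hη] at h
    have hc := h.eqOn_const hf
    rintro _ ⟨t, ht, rfl⟩ _ ⟨r, hr, rfl⟩ -
    rw [hc ht, hc hr]
  · rintro _ ⟨t, ht, rfl⟩ _ ⟨r, hr, rfl⟩ htr
    rw [h.eq t ht, h.eq r hr] at htr
    rw [smul_left_injective ℝ (sub_ne_zero.2 hη) (add_left_cancel htr)]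

/-- Local injectivity, together with injectivity on the compact lifted path, gives injectivity on a
neighbourhood `N`. The inverse on the open set `f '' N` is continuous and lifts all nearby segments
into `N`; staying in `N` is what later identifies their endpoints. -/
theorem IsSegmentLift.exists_nhds (hf : IsLocalHomeoWithin f s) (hs : IsOpen s) {x η : E}
    {σ : ℝ → E} (h : IsSegmentLift f s x η σ) :
    ∃ N : Set E, IsOpen N ∧ N ⊆ s ∧ σ '' Icc 0 1 ⊆ N ∧ InjOn f N ∧
      ∀ᶠ p : E × E in 𝓝 (x, η), ∃ σ', IsSegmentLift f s p.1 p.2 σ' ∧ MapsTo σ' (Icc 0 1) N := by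
  have hcpt : IsCompact (σ '' Icc 0 1) := isCompact_Icc.image_of_continuousOn h.continuousOn
  have hsub : σ '' Icc 0 1 ⊆ s := h.mapsTo.image_subset
  obtain ⟨N', hN', hinj'⟩ := (h.injOn_image hf).exists_mem_nhdsSet hcpt
    (fun y hy => hf.continuousAt (hsub hy)) (fun y hy => hf.exists_injOn (hsub hy))
  obtain ⟨N₁, hN₁, hσN₁, hN₁N'⟩ := mem_nhdsSet_iff_exists.1 hN'
  set N := N₁ ∩ s with hNdef
  have hN : IsOpen N := hN₁.inter hs
  have hNs : N ⊆ s := inter_subset_right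
  have hinj : InjOn f N := hinj'.mono (inter_subset_left.trans hN₁N')
  have hσN : σ '' Icc 0 1 ⊆ N := subset_inter hσN₁ hsub
  refine ⟨N, hN, hNs, hσN, hinj, ?_⟩
  set g := Function.invFunOn f N with hg
  have hgf : ∀ y ∈ N, g (f y) = y := fun y hy => hinj.leftInvOn_invFunOn hy
  have hW := hf.isOpen_image hN hNs
  have hgc : ContinuousOn g (f '' N) := by
    rintro _ ⟨y, hy, rfl⟩
    refine ContinuousAt.continuousWithinAt ?_
    intro U hU
    rw [hgf y hy] at hU
    obtain ⟨U', hU', hU'o, hyU'⟩ := mem_nhds_iff.1 hU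
    have h1 := (hf.isOpen_image (hU'o.inter hN) (inter_subset_right.trans hNs)).mem_nhds
      (mem_image_of_mem f ⟨hyU', hy⟩)
    refine mem_map.2 (mem_of_superset h1 ?_)
    rintro _ ⟨z, hz, rfl⟩
    rw [mem_preimage, hgf z hz.2]
    exact hU' hz.1
  have hxN : x ∈ N := hσN ⟨0, left_mem_Icc.2 zero_le_one, h.zero⟩
  have hev : ∀ᶠ p : E × E in 𝓝 (x, η), ∀ t ∈ Icc (0 : ℝ) 1, f p.1 + t • (p.2 - f p.1) ∈ f '' N := by
    refine isCompact_Icc.eventually_forall_of_forall_eventually fun t ht => ?_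
    have hmem : f x + t • (η - f x) ∈ f '' N := by
      rw [← h.eq t ht]
      exact mem_image_of_mem f (hσN (mem_image_of_mem σ ht))
    have hfc : ContinuousAt (fun z : (E × E) × ℝ => f z.1.1) ((x, η), t) :=
      ContinuousAt.comp (f := fun z : (E × E) × ℝ => z.1.1) (hf.continuousAt (hNs hxN))
        (by fun_prop)
    have hc : ContinuousAt (fun z : (E × E) × ℝ => f z.1.1 + z.2 • (z.1.2 - f z.1.1))
        ((x, η), t) := hfc.add (continuousAt_snd.smul (ContinuousAt.sub (by fun_prop) hfc))
    exact hc.preimage_mem_nhds (hW.mem_nhds hmem)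
  have hevN : ∀ᶠ p : E × E in 𝓝 (x, η), p.1 ∈ N :=
    continuous_fst.continuousAt.preimage_mem_nhds (hN.mem_nhds hxN)
  filter_upwards [hev, hevN] with p hp hpN
  have hgN : ∀ y ∈ f '' N, g y ∈ N := fun y hy => Function.invFunOn_mem hy
  have hfg : ∀ y ∈ f '' N, f (g y) = y := fun y hy => Function.invFunOn_eq hy
  refine ⟨fun t => g (f p.1 + t • (p.2 - f p.1)), ⟨?_, ?_, ?_, ?_⟩, ?_⟩
  · simp [hgf p.1 hpN]
  · exact hgc.comp (by fun_prop) hp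
  · exact fun t ht => hNs (hgN _ (hp t ht))
  · exact fun t ht => hfg _ (hp t ht)
  · exact fun t ht => hgN _ (hp t ht)

/-- Limits of lifts which stay in a compact set are lifts. -/
theorem IsLocalHomeoWithin.exists_isSegmentLift_of_ultrafilter (hf : IsLocalHomeoWithin f s)
    {K : Set E} (hK : IsCompact K) (hKs : K ⊆ s) {ι : Type*} (𝒰 : Ultrafilter ι) {x η : ι → E}
    {σ : ι → ℝ → E} {x₀ η₀ : E} (hx : Tendsto x 𝒰 (𝓝 x₀)) (hη : Tendsto η 𝒰 (𝓝 η₀))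
    (hx₀ : x₀ ∈ s) (hσ : ∀ᶠ i in (𝒰 : Filter ι), IsSegmentLift f s (x i) (η i) (σ i))
    (hσK : ∀ᶠ i in (𝒰 : Filter ι), MapsTo (σ i) (Icc 0 1) K) :
    ∃ σ₀, IsSegmentLift f s x₀ η₀ σ₀ ∧
      ∀ t ∈ Icc (0 : ℝ) 1, Tendsto (fun i => σ i t) 𝒰 (𝓝 (σ₀ t)) := by
  -- Compactness of `K` gives pointwise limits along the ultrafilter without any equicontinuity;
  -- continuity of the limit path is recovered afterwards from a local inverse.
  have hlim : ∀ t ∈ Icc (0 : ℝ) 1, ∃ a ∈ K, Tendsto (fun i => σ i t) 𝒰 (𝓝 a) := by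
    intro t ht
    have : Tendsto (fun i => σ i t) 𝒰 (𝓟 K) := tendsto_principal.2 (hσK.mono fun i hi => hi ht)
    exact hK.ultrafilter_le_nhds (𝒰.map fun i => σ i t) this
  choose! σ₀ hσ₀K hσ₀ using hlim
  have hfx : Tendsto (fun i => f (x i)) 𝒰 (𝓝 (f x₀)) := (hf.continuousAt hx₀).tendsto.comp hx
  have hp : ∀ t : ℝ, Tendsto (fun i => f (x i) + t • (η i - f (x i))) 𝒰
      (𝓝 (f x₀ + t • (η₀ - f x₀))) := fun t => hfx.add ((hη.sub hfx).const_smul t)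
  have heq : ∀ t ∈ Icc (0 : ℝ) 1, f (σ₀ t) = f x₀ + t • (η₀ - f x₀) := by
    intro t ht
    refine tendsto_nhds_unique (((hf.continuousAt (hKs (hσ₀K t ht))).tendsto.comp (hσ₀ t ht)))
      ((hp t).congr' ?_)
    filter_upwards [hσ] with i hi using (hi.eq t ht).symm
  refine ⟨σ₀, ⟨?_, ?_, fun t ht => hKs (hσ₀K t ht), heq⟩, hσ₀⟩
  · refine tendsto_nhds_unique (hσ₀ 0 (left_mem_Icc.2 zero_le_one)) (hx.congr' ?_)
    filter_upwards [hσ] with i hi using hi.zero.symm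
  intro t₀ ht₀
  obtain ⟨e, hze, hes, he⟩ := hf (σ₀ t₀) (hKs (hσ₀K t₀ ht₀))
  have hc : ContinuousAt (fun z : (E × E) × ℝ => z.1.1 + z.2 • (z.1.2 - z.1.1))
      ((f x₀, η₀), t₀) := by fun_prop
  have hW : e.target ∈ 𝓝 (f x₀ + t₀ • (η₀ - f x₀)) := by
    rw [← heq t₀ ht₀, he hze]
    exact e.open_target.mem_nhds (e.map_source hze)
  have hpre := hc.preimage_mem_nhds hW
  rw [nhds_prod_eq] at hpre
  obtain ⟨A, hA, B, hB, hAB⟩ := mem_prod_iff.1 hpre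
  obtain ⟨δ, hδ, hδB⟩ := Metric.mem_nhds_iff.1 hB
  set T := Icc (0 : ℝ) 1 ∩ Metric.ball t₀ δ with hT
  have hTp : IsPreconnected T := ((convex_Icc 0 1).inter (convex_ball t₀ δ)).isPreconnected
  have hT0 : t₀ ∈ T := ⟨ht₀, Metric.mem_ball_self hδ⟩
  have hA' : ∀ᶠ i in (𝒰 : Filter ι), (f (x i), η i) ∈ A := (hfx.prodMk_nhds hη) hA
  have hsrc : ∀ᶠ i in (𝒰 : Filter ι), σ i t₀ ∈ e.source :=
    (hσ₀ t₀ ht₀) (e.open_source.mem_nhds hze)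
  have hA₀ : (f x₀, η₀) ∈ A := mem_of_mem_nhds hA
  -- Near `t₀` all late lifts coincide with the same local inverse applied to their segments, by
  -- uniqueness of lifts, so the limit does too.
  have hloc : ∀ t ∈ T, σ₀ t = e.symm (f x₀ + t • (η₀ - f x₀)) := by
    intro t ht
    have hmem : f x₀ + t • (η₀ - f x₀) ∈ e.target := by
      have : (((f x₀, η₀), t) : (E × E) × ℝ) ∈ A ×ˢ B := ⟨hA₀, hδB ht.2⟩
      exact hAB this
    refine tendsto_nhds_unique (hσ₀ t ht.1)
      (((e.symm.continuousAt hmem).tendsto.comp (hp t)).congr' ?_)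
    filter_upwards [hσ, hA', hsrc] with i hi hiA hisrc
    have hmem' : ∀ r ∈ T, f (x i) + r • (η i - f (x i)) ∈ e.target := by
      intro r hr
      have : (((f (x i), η i), r) : (E × E) × ℝ) ∈ A ×ˢ B := ⟨hiA, hδB hr.2⟩
      exact hAB this
    have huniq := hf.eqOn_of_isPreconnected hTp (hi.continuousOn.mono inter_subset_left)
      (τ := fun r => e.symm (f (x i) + r • (η i - f (x i))))
      (e.symm.continuousOn.comp (by fun_prop) hmem') (fun r hr => hi.mapsTo hr.1)
      (fun r hr => by
        rw [hi.eq r hr.1, he (e.map_target (hmem' r hr)), e.right_inv (hmem' r hr)]) hT0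
      (by rw [← hi.eq t₀ ht₀, he hisrc, e.left_inv hisrc])
    exact (huniq ht).symm
  have hmem : f x₀ + t₀ • (η₀ - f x₀) ∈ e.target := mem_of_mem_nhds hW
  have hcont : ContinuousAt (fun t : ℝ => e.symm (f x₀ + t • (η₀ - f x₀))) t₀ :=
    ContinuousAt.comp (f := fun t : ℝ => f x₀ + t • (η₀ - f x₀)) (e.symm.continuousAt hmem)
      (by fun_prop)
  refine hcont.continuousWithinAt.congr_of_eventuallyEq ?_ (hloc t₀ hT0)
  filter_upwards [inter_mem_nhdsWithin (Icc 0 1) (Metric.ball_mem_nhds t₀ hδ)] with t ht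
    using hloc t ht

/-- If there is a proper function which along every lifted segment is bounded by its values at the
endpoints, then any two points are joined by a lifted segment. -/
theorem IsLocalHomeoWithin.exists_isSegmentLift_of_proper (hf : IsLocalHomeoWithin f s)
    (hs : IsOpen s) (hsc : IsPreconnected s) {ρ : E → ℝ} (hρ : ContinuousOn ρ s)
    (hproper : ∀ c, ∃ K ⊆ s, IsCompact K ∧ ∀ x ∈ s, ρ x ≤ c → x ∈ K)
    (hmax : ∀ x η σ, IsSegmentLift f s x η σ → ∀ t ∈ Icc (0 : ℝ) 1, ρ (σ t) ≤ max (ρ x) (ρ (σ 1)))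
    {x y : E} (hx : x ∈ s) (hy : y ∈ s) : ∃ σ, IsSegmentLift f s x (f y) σ ∧ σ 1 = y := by
  have : PreconnectedSpace s := isPreconnected_iff_preconnectedSpace.1 hsc
  -- The pairs joined by a lift form a nonempty open and closed subset of the connected space `s ×
  -- s`.
  set S : Set (s × s) := {p | ∃ σ, IsSegmentLift f s p.1 (f p.2) σ ∧ σ 1 = p.2} with hS
  have hopen : IsOpen S := by
    rw [isOpen_iff_mem_nhds]
    rintro ⟨x, y⟩ ⟨σ, hσ, hσ1⟩
    obtain ⟨N, hN, hNs, hσN, hinj, hev⟩ := hσ.exists_nhds hf hs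
    have hyN : (y : E) ∈ N := hσN ⟨1, right_mem_Icc.2 zero_le_one, hσ1⟩
    have hc : ContinuousAt (fun p : s × s => ((p.1 : E), f p.2)) (x, y) := by
      refine ContinuousAt.prodMk (by fun_prop) ?_
      exact ContinuousAt.comp (f := fun p : s × s => (p.2 : E)) (hf.continuousAt y.2) (by fun_prop)
    have hyev : ∀ᶠ p : s × s in 𝓝 (x, y), (p.2 : E) ∈ N :=
      (continuous_subtype_val.comp continuous_snd).continuousAt.preimage_mem_nhds (hN.mem_nhds hyN)
    filter_upwards [hc.eventually hev, hyev] with p hp hpN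
    obtain ⟨σ', hσ', hσ'N⟩ := hp
    exact ⟨σ', hσ', hinj (hσ'N (right_mem_Icc.2 zero_le_one)) hpN hσ'.map_one⟩
  have hclosed : IsClosed S := by
    rw [isClosed_iff_ultrafilter]
    rintro ⟨x, y⟩ 𝒰 h𝒰 hS𝒰
    have hch : ∀ p : s × s, ∃ σ, p ∈ S → IsSegmentLift f s p.1 (f p.2) σ ∧ σ 1 = p.2 := by
      intro p
      by_cases hp : p ∈ S
      · obtain ⟨σ, hσ⟩ := hp
        exact ⟨σ, fun _ => hσ⟩
      · exact ⟨fun _ => 0, fun h => absurd h hp⟩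
    choose σ hσ using hch
    have hx : Tendsto (fun p : s × s => (p.1 : E)) 𝒰 (𝓝 x) :=
      ((continuous_subtype_val.comp continuous_fst).tendsto (x, y)).mono_left h𝒰
    have hy : Tendsto (fun p : s × s => (p.2 : E)) 𝒰 (𝓝 y) :=
      ((continuous_subtype_val.comp continuous_snd).tendsto (x, y)).mono_left h𝒰
    have hη : Tendsto (fun p : s × s => f p.2) 𝒰 (𝓝 (f y)) :=
      (hf.continuousAt y.2).tendsto.comp hy
    have hρx := (hρ.continuousAt (hs.mem_nhds x.2)).tendsto.comp hx
    have hρy := (hρ.continuousAt (hs.mem_nhds y.2)).tendsto.comp hy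
    -- The margin 1 absorbs the variation of `ρ` at the endpoints near the limit pair, so one
    -- compact set contains all late lifts.
    obtain ⟨K, hKs, hK, hKρ⟩ := hproper (max (ρ x + 1) (ρ y + 1))
    have hSe : ∀ᶠ p in (𝒰 : Filter (s × s)), p ∈ S := hS𝒰
    obtain ⟨σ₀, hσ₀, hlim⟩ := hf.exists_isSegmentLift_of_ultrafilter hK hKs 𝒰 (σ := σ) hx hη x.2
      (hSe.mono fun p hp => (hσ p hp).1) (by
        filter_upwards [hSe, hρx.eventually_le_const (lt_add_one _),
          hρy.eventually_le_const (lt_add_one _)] with p hp hpx hpy t ht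
        refine hKρ _ ((hσ p hp).1.mapsTo ht) ((hmax _ _ _ (hσ p hp).1 t ht).trans ?_)
        rw [(hσ p hp).2]
        exact max_le_max hpx hpy)
    refine ⟨σ₀, hσ₀, tendsto_nhds_unique (hlim 1 (right_mem_Icc.2 zero_le_one)) (hy.congr' ?_)⟩
    filter_upwards [hSe] with p hp using (hσ p hp).2.symm
  have huniv := IsClopen.eq_univ ⟨hclosed, hopen⟩ ⟨(⟨x, hx⟩, ⟨x, hx⟩), fun _ => x,
    ⟨rfl, continuousOn_const, fun _ _ => hx, fun t _ => by simp⟩, rfl⟩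
  have : ((⟨x, hx⟩, ⟨y, hy⟩) : s × s) ∈ S := huniv ▸ mem_univ _
  exact this

/-- If the lifts of initial parts of a segment stay in a compact set, then the segment lifts. -/
theorem IsLocalHomeoWithin.exists_isSegmentLift_of_compact (hf : IsLocalHomeoWithin f s)
    (hs : IsOpen s) {x η : E} (hx : x ∈ s) {K : Set E} (hK : IsCompact K) (hKs : K ⊆ s)
    (h : ∀ τ ∈ Icc (0 : ℝ) 1, ∀ σ, IsSegmentLift f s x (f x + τ • (η - f x)) σ →
      MapsTo σ (Icc 0 1) K) : ∃ σ, IsSegmentLift f s x η σ := by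
  set S : Set (Icc (0 : ℝ) 1) := {τ | ∃ σ, IsSegmentLift f s x (f x + (τ : ℝ) • (η - f x)) σ}
  have hopen : IsOpen S := by
    rw [isOpen_iff_mem_nhds]
    rintro τ ⟨σ, hσ⟩
    obtain ⟨N, -, -, -, -, hev⟩ := hσ.exists_nhds hf hs
    have hc : ContinuousAt (fun r : Icc (0 : ℝ) 1 => (x, f x + (r : ℝ) • (η - f x))) τ := by
      fun_prop
    filter_upwards [hc.eventually hev] with r hr
    obtain ⟨σ', hσ', -⟩ := hr
    exact ⟨σ', hσ'⟩
  have hclosed : IsClosed S := by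
    rw [isClosed_iff_ultrafilter]
    rintro τ 𝒰 h𝒰 hS𝒰
    have hch : ∀ r : Icc (0 : ℝ) 1, ∃ σ, r ∈ S →
        IsSegmentLift f s x (f x + (r : ℝ) • (η - f x)) σ := by
      intro r
      by_cases hr : r ∈ S
      · obtain ⟨σ, hσ⟩ := hr
        exact ⟨σ, fun _ => hσ⟩
      · exact ⟨fun _ => 0, fun h => absurd h hr⟩
    choose σ hσ using hch
    have hSe : ∀ᶠ p in (𝒰 : Filter (Icc (0 : ℝ) 1)), p ∈ S := hS𝒰
    have hc : Continuous (fun r : Icc (0 : ℝ) 1 => f x + (r : ℝ) • (η - f x)) := by fun_prop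
    obtain ⟨σ₀, hσ₀, -⟩ := hf.exists_isSegmentLift_of_ultrafilter hK hKs 𝒰 (σ := σ)
      (tendsto_const_nhds (x := x)) ((hc.tendsto τ).mono_left h𝒰) hx
      (hSe.mono fun p hp => hσ p hp) (hSe.mono fun p hp => h p p.2 _ (hσ p hp))
    exact ⟨σ₀, hσ₀⟩
  have huniv := IsClopen.eq_univ ⟨hclosed, hopen⟩ ⟨⟨0, left_mem_Icc.2 zero_le_one⟩, fun _ => x,
    ⟨rfl, continuousOn_const, fun _ _ => hx, fun t _ => by simp⟩⟩
  have h1 : (⟨1, right_mem_Icc.2 zero_le_one⟩ : Icc (0 : ℝ) 1) ∈ S := huniv ▸ mem_univ _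
  obtain ⟨σ, hσ⟩ := h1
  exact ⟨σ, by simpa using hσ⟩

end SegmentLift

/-! ### Smooth local inverses and calculus along lifted curves. -/

section LocalInverse

open Filter Topology

theorem exists_localInverse {f : KPlane → KPlane} {s : Set KPlane} (hs : IsOpen s)
    (hf : ContDiffOn ℝ ∞ f s) (h : ∀ x ∈ s, ∀ v, v ≠ 0 → fderiv ℝ f x v ≠ 0) {x : KPlane}
    (hx : x ∈ s) : ∃ e : OpenPartialHomeomorph KPlane KPlane, x ∈ e.source ∧ e.source ⊆ s ∧
      EqOn f e e.source ∧ ContDiffAt ℝ ∞ e.symm (f x) := by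
  have hinj : Function.Injective (fderiv ℝ f x : KPlane →ₗ[ℝ] KPlane) := by
    refine (injective_iff_map_eq_zero _).2 fun v hv => ?_
    by_contra hne
    exact h x hx v hne hv
  set L : KPlane ≃L[ℝ] KPlane :=
    (LinearEquiv.ofInjectiveEndo (fderiv ℝ f x : KPlane →ₗ[ℝ] KPlane) hinj).toContinuousLinearEquiv
  have hL : HasFDerivAt f (L : KPlane →L[ℝ] KPlane) x :=
    (hf.differentiableAt_of_isOpen hs hx).hasFDerivAt.congr_fderiv (by ext1 v; rfl)
  have hfx := hf.contDiffAt (hs.mem_nhds hx)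
  set e := hfx.toOpenPartialHomeomorph f hL (by simp)
  have he : ⇑e = f := hfx.toOpenPartialHomeomorph_coe hL (by simp)
  refine ⟨e.restrOpen s hs, ⟨hfx.mem_toOpenPartialHomeomorph_source hL (by simp), hx⟩,
    fun y hy => hy.2, fun y hy => by simp [he], ?_⟩
  exact hfx.to_localInverse hL (by simp)

theorem isLocalHomeoWithin_of_fderiv {f : KPlane → KPlane} {s : Set KPlane} (hs : IsOpen s)
    (hf : ContDiffOn ℝ ∞ f s) (h : ∀ x ∈ s, ∀ v, v ≠ 0 → fderiv ℝ f x v ≠ 0) :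
    IsLocalHomeoWithin f s := fun x hx => by
  obtain ⟨e, h1, h2, h3, -⟩ := exists_localInverse hs hf h hx
  exact ⟨e, h1, h2, h3⟩

theorem IsSegmentLift.contDiffAt {f : KPlane → KPlane} {s : Set KPlane} (hs : IsOpen s)
    (hf : ContDiffOn ℝ ∞ f s) (h : ∀ x ∈ s, ∀ v, v ≠ 0 → fderiv ℝ f x v ≠ 0) {x η : KPlane}
    {σ : ℝ → KPlane} (hσ : IsSegmentLift f s x η σ) {t : ℝ} (ht : t ∈ Ioo (0 : ℝ) 1) :
    ContDiffAt ℝ ∞ σ t := by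
  have ht' := Ioo_subset_Icc_self ht
  obtain ⟨e, h1, -, h3, h4⟩ := exists_localInverse hs hf h (hσ.mapsTo ht')
  have hline : ContDiffAt ℝ ∞ (fun r : ℝ => f x + r • (η - f x)) t := by fun_prop
  have hc : ContDiffAt ℝ ∞ (fun r : ℝ => e.symm (f x + r • (η - f x))) t := by
    refine ContDiffAt.comp (f := fun r : ℝ => f x + r • (η - f x)) t ?_ hline
    rw [← hσ.eq t ht']
    exact h4
  refine hc.congr_of_eventuallyEq ?_
  have hIcc : Icc (0 : ℝ) 1 ∈ 𝓝 t := Icc_mem_nhds ht.1 ht.2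
  filter_upwards [hIcc, (hσ.continuousOn.continuousAt hIcc).preimage_mem_nhds
    (e.open_source.mem_nhds h1)] with r hr hre
  rw [← hσ.eq r hr, h3 hre, e.left_inv hre]

/-- A function whose interior critical points are nondegenerate minima is bounded by its values at
the endpoints. -/
theorem le_max_of_deriv_deriv_pos {ρ : ℝ → ℝ} (hρ : ContinuousOn ρ (Icc 0 1))
    (h : ∀ t ∈ Ioo (0 : ℝ) 1, deriv ρ t = 0 → 0 < deriv (deriv ρ) t) :
    ∀ t ∈ Icc (0 : ℝ) 1, ρ t ≤ max (ρ 0) (ρ 1) := by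
  obtain ⟨m, hm, hmax⟩ := isCompact_Icc.exists_isMaxOn (nonempty_Icc.2 zero_le_one) hρ
  intro t ht
  refine (hmax ht).trans ?_
  rcases eq_or_lt_of_le hm.1 with h0 | h0
  · rw [← h0]; exact le_max_left _ _
  rcases eq_or_lt_of_le hm.2 with h1 | h1
  · rw [h1]; exact le_max_right _ _
  exfalso
  have hIcc : Icc (0 : ℝ) 1 ∈ 𝓝 m := Icc_mem_nhds h0 h1
  have hlmax : IsLocalMax ρ m := hmax.isLocalMax hIcc
  have hpos := h m ⟨h0, h1⟩ hlmax.deriv_eq_zero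
  -- An interior maximum would also be a local minimum, so the function would be locally constant
  -- there, with vanishing second derivative.
  have hlmin := isLocalMin_of_deriv_deriv_pos hpos hlmax.deriv_eq_zero (hρ.continuousAt hIcc)
  have hconst : ρ =ᶠ[𝓝 m] fun _ => ρ m := by
    filter_upwards [hlmax, hlmin] with r h1 h2 using le_antisymm h1 h2
  have := hconst.deriv.deriv_eq
  simp at this
  exact hpos.ne' this

/-- Second derivative of a smooth map along a smooth curve. -/
theorem hasDerivAt_comp_curve {E : Type*} [NormedAddCommGroup E] [NormedSpace ℝ E]
    {Q : KPlane → E} {s : Set KPlane} (hs : IsOpen s) (hQ : ContDiffOn ℝ ∞ Q s) {σ : ℝ → KPlane}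
    {I : Set ℝ} (hI : IsOpen I) (hσ : ∀ t ∈ I, ContDiffAt ℝ ∞ σ t) (hσs : MapsTo σ I s) {t : ℝ}
    (ht : t ∈ I) :
    HasDerivAt (fun r => Q (σ r)) (fderiv ℝ Q (σ t) (deriv σ t)) t ∧
      HasDerivAt (deriv fun r => Q (σ r))
        (fderiv ℝ (fderiv ℝ Q) (σ t) (deriv σ t) (deriv σ t) +
          fderiv ℝ Q (σ t) (deriv (deriv σ) t)) t := by
  have h1 : ∀ t ∈ I, HasDerivAt (fun r => Q (σ r)) (fderiv ℝ Q (σ t) (deriv σ t)) t := fun t ht =>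
    (hQ.differentiableAt_of_isOpen hs (hσs ht)).hasFDerivAt.comp_hasDerivAt t
      ((hσ t ht).differentiableAt (by simp)).hasDerivAt
  refine ⟨h1 t ht, ?_⟩
  have hev : (deriv fun r => Q (σ r)) =ᶠ[𝓝 t] fun r => fderiv ℝ Q (σ r) (deriv σ r) := by
    filter_upwards [hI.mem_nhds ht] with r hr using (h1 r hr).deriv
  refine HasDerivAt.congr_of_eventuallyEq ?_ hev
  have hσ2 : DifferentiableAt ℝ (deriv σ) t := by
    have hon : ContDiffOn ℝ ∞ σ I := fun r hr => (hσ r hr).contDiffWithinAt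
    exact (((contDiffOn_infty_iff_deriv_of_isOpen hI).1 hon).2.contDiffAt
      (hI.mem_nhds ht)).differentiableAt (by simp)
  have hQ2 := ((hQ.fderiv_infty hs).differentiableAt_of_isOpen hs
    (hσs ht)).hasFDerivAt.comp_hasDerivAt t ((hσ t ht).differentiableAt (by simp)).hasDerivAt
  exact hQ2.clm_apply hσ2.hasDerivAt

end LocalInverse

/-! ### Lifted chords: injectivity and convexity of the image. -/

namespace IsCodazziImmersion

variable {F : KPlane → KPlane} {b : KPlane → KPlane →L[ℝ] KPlane} {X : KPlane → KPlane × ℝ}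

theorem isLocalHomeoWithin (h : IsCodazziImmersion F b X) : IsLocalHomeoWithin F kleinDisc :=
  isLocalHomeoWithin_of_fderiv isOpen_kleinDisc h.smooth fun _ hx _ hv => h.fderiv_ne_zero hx hv

open Filter Topology in
/-- Along the lift of a segment through `F` the height function satisfies a second order
differential equation with positive right hand side. -/
theorem deriv_deriv_snd_pos (h : IsCodazziImmersion F b X) {x η : KPlane} (hη : η ≠ F x)
    {σ : ℝ → KPlane} (hσ : IsSegmentLift F kleinDisc x η σ) {t : ℝ} (ht : t ∈ Ioo (0 : ℝ) 1)
    (h0 : deriv (fun r => (X (σ r)).2) t = 0) :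
    0 < deriv (deriv fun r => (X (σ r)).2) t := by
  have hσs : ∀ r ∈ Ioo (0 : ℝ) 1, ContDiffAt ℝ ∞ σ r := fun r hr =>
    hσ.contDiffAt isOpen_kleinDisc h.smooth (fun _ hx _ hv => h.fderiv_ne_zero hx hv) hr
  have hσm : MapsTo σ (Ioo 0 1) kleinDisc := hσ.mapsTo.mono_left Ioo_subset_Icc_self
  set w := η - F x with hw
  set q : ℝ → KPlane := fun r => F x + r • w with hq
  have hqeq : ∀ r ∈ Ioo (0 : ℝ) 1, F (σ r) = q r := fun r hr => hσ.eq r (Ioo_subset_Icc_self hr)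
  have hqs : ∀ r ∈ Ioo (0 : ℝ) 1, ContDiffAt ℝ ∞ q r := fun r _ => by fun_prop
  have hqm : MapsTo q (Ioo 0 1) kleinDisc := fun r hr => hqeq r hr ▸ h.mapsTo (hσm hr)
  have hqd : deriv q = fun _ => w := by
    funext r
    have := ((hasDerivAt_id r).smul_const w).const_add (F x)
    rw [one_smul] at this
    exact this.deriv
  set I : Set ℝ := Ioo 0 1
  have hI : IsOpen I := isOpen_Ioo
  have hev : ∀ᶠ r in 𝓝 t, r ∈ I := hI.mem_nhds ht
  have hx := hσm ht
  have hX := hasDerivAt_comp_curve isOpen_kleinDisc h.contDiffOn hI hσs hσm ht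
  have hP := hasDerivAt_comp_curve isOpen_kleinDisc h.contDiffOn_lift hI hσs hσm ht
  have hN := hasDerivAt_comp_curve isOpen_kleinDisc contDiffOn_hypLift hI hqs hqm ht
  have hF := hasDerivAt_comp_curve isOpen_kleinDisc h.smooth hI hσs hσm ht
  have hPN : (fun r => hypLift (F (σ r))) =ᶠ[𝓝 t] fun r => hypLift (q r) :=
    hev.mono fun r hr => by simp only [hqeq r hr]
  have hFq : (fun r => F (σ r)) =ᶠ[𝓝 t] q := hev.mono fun r hr => hqeq r hr
  have hFw : fderiv ℝ F (σ t) (deriv σ t) = w := by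
    rw [← hF.1.deriv, hFq.deriv_eq, hqd]
  have hσ0 : deriv σ t ≠ 0 := by
    intro h1
    rw [h1, map_zero] at hFw
    exact hη (sub_eq_zero.1 hFw.symm)
  obtain ⟨c, hc1, hc2⟩ := h.exists_gauss_formula hx (deriv σ t) (deriv σ t)
  -- Differentiating N along the straight chord `q` in two ways compares the acceleration of the
  -- lift with that of a chord; the normal parts agree because `F` pulls h back to h(b·, b·).
  have e := hPN.deriv.deriv_eq
  rw [hP.2.deriv, hN.2.deriv, hqd, deriv_const, map_zero, add_zero, hc2,
    fderiv_fderiv_hypLift (hqm ht), ← h.metric _ hx, hFw, hqeq t ht, add_right_comm] at e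
  have e' := add_right_cancel e
  -- Chords are geodesics up to parametrization, so the Christoffel term is a multiple of the
  -- velocity.
  have hΓ : kleinChristoffel (q t) w w =
      ((1 - ‖q t‖ ^ 2)⁻¹ * (2 * inner ℝ (q t) w)) • w := by
    rw [kleinChristoffel]
    module
  rw [hΓ, ← hqeq t ht, ← hFw, ← map_smul, ← h.fderiv_lift hx, ← map_add] at e'
  have e'' := h.fderiv_lift_injective hx e'
  set l := (1 - ‖F (σ t)‖ ^ 2)⁻¹ * (2 * inner ℝ (F (σ t)) (fderiv ℝ F (σ t) (deriv σ t)))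
  have hX2 := hX.2
  -- With σ'' + c = lσ', the same tangential vector `c` in both Gauss formulas gives (X ∘ σ)'' = l
  -- (X ∘ σ)' + h(σ', bσ') N. At a critical point of the height only the positive last term remains.
  rw [hc1, add_right_comm, ← map_add, e'', map_smul] at hX2
  have d1 : ∀ r ∈ I, deriv (fun r => (X (σ r)).2) r = (deriv (fun r => X (σ r)) r).2 := by
    intro r hr
    have := hasDerivAt_comp_curve isOpen_kleinDisc h.contDiffOn hI hσs hσm hr
    rw [this.1.deriv]
    simpa using (HasFDerivAt.hasDerivAt (HasFDerivAt.snd this.1.hasFDerivAt)).deriv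
  have d2 : deriv (deriv fun r => (X (σ r)).2) t =
      (l • fderiv ℝ X (σ t) (deriv σ t) +
        kleinMetric (σ t) (deriv σ t) (b (σ t) (deriv σ t)) • hypLift (σ t)).2 := by
    have hev' : (deriv fun r => (X (σ r)).2) =ᶠ[𝓝 t] fun r => (deriv (fun r => X (σ r)) r).2 :=
      hev.mono d1
    rw [hev'.deriv_eq]
    simpa using (HasFDerivAt.hasDerivAt (HasFDerivAt.snd hX2.hasFDerivAt)).deriv
  rw [d1 t ht, hX.1.deriv] at h0
  rw [d2]
  have hp := h.pos _ hx _ hσ0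
  rw [kleinMetric_symm] at hp
  simp only [Prod.snd_add, Prod.smul_snd, h0, hypLift, smul_eq_mul, mul_zero, mul_one, zero_add]
  exact mul_pos hp (lorentzFactor_pos hx)

/-- The height serves as the proper function: it has compact sublevel sets and no interior maximum
along a nonconstant lift. -/
theorem exists_isSegmentLift (h : IsCodazziImmersion F b X) {x y : KPlane} (hx : x ∈ kleinDisc)
    (hy : y ∈ kleinDisc) : ∃ σ, IsSegmentLift F kleinDisc x (F y) σ ∧ σ 1 = y := by
  refine h.isLocalHomeoWithin.exists_isSegmentLift_of_proper isOpen_kleinDisc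
    convex_kleinDisc.isPreconnected h.continuousOn_snd ?_ ?_ hx hy
  · intro c
    obtain ⟨r, hr, hr'⟩ := h.exists_norm_lt_of_snd_le c
    exact ⟨Metric.closedBall 0 r, Metric.closedBall_subset_ball hr, isCompact_closedBall 0 r,
      fun x hx hc => by simpa using hr' x hx hc⟩
  · intro x η σ hσ t ht
    by_cases hη : η = F x
    · rw [hη] at hσ
      rw [hσ.eqOn_const h.isLocalHomeoWithin ht]
      exact le_max_left _ _
    · have := le_max_of_deriv_deriv_pos (h.continuousOn_snd.comp hσ.continuousOn hσ.mapsTo)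
        (fun t ht => h.deriv_deriv_snd_pos hη hσ ht) t ht
      simpa [hσ.zero] using this

/-- Two points with the same image are joined by the lift of a constant segment, and such a lift is
constant. -/
theorem injOn (h : IsCodazziImmersion F b X) : InjOn F kleinDisc := by
  intro x hx y hy hxy
  obtain ⟨σ, hσ, hσ1⟩ := h.exists_isSegmentLift hx hy
  rw [← hxy] at hσ
  rw [← hσ1, hσ.eqOn_const h.isLocalHomeoWithin (right_mem_Icc.2 zero_le_one)]

theorem isOpen_image (h : IsCodazziImmersion F b X) : IsOpen (F '' kleinDisc) :=
  h.isLocalHomeoWithin.isOpen_image isOpen_kleinDisc Subset.rfl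

theorem convex_image (h : IsCodazziImmersion F b X) : Convex ℝ (F '' kleinDisc) := by
  rw [convex_iff_add_mem]
  rintro _ ⟨x, hx, rfl⟩ _ ⟨y, hy, rfl⟩ a c ha hc hac
  obtain ⟨σ, hσ, -⟩ := h.exists_isSegmentLift hx hy
  have hcI : c ∈ Icc (0 : ℝ) 1 := ⟨hc, by linarith⟩
  refine ⟨σ c, hσ.mapsTo hcI, ?_⟩
  rw [hσ.eq c hcI, eq_sub_iff_add_eq.2 hac]
  module

open Filter Topology in
theorem isDiffeoOnto_image (h : IsCodazziImmersion F b X) :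
    IsDiffeoOnto F kleinDisc (F '' kleinDisc) := by
  have hl := h.injOn.leftInvOn_invFunOn
  refine ⟨h.injOn.bijOn_image, h.smooth, Function.invFunOn F kleinDisc, ?_, hl,
    fun y hy => Function.invFunOn_eq hy⟩
  rintro _ ⟨x, hx, rfl⟩
  obtain ⟨e, h1, h2, h3, h4⟩ := exists_localInverse isOpen_kleinDisc h.smooth
    (fun _ hx _ hv => h.fderiv_ne_zero hx hv) hx
  refine (h4.congr_of_eventuallyEq ?_).contDiffWithinAt
  have : e.target ∈ 𝓝 (F x) := by
    rw [h3 h1]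
    exact e.open_target.mem_nhds (e.map_source h1)
  filter_upwards [this] with y hy
  have hs := e.map_target hy
  conv_lhs => rw [← e.right_inv hy, ← h3 hs]
  exact hl (h2 hs)

end IsCodazziImmersion

/-! ### The dual immersion. -/

namespace IsCodazziImmersion

variable {F : KPlane → KPlane} {b : KPlane → KPlane →L[ℝ] KPlane} {X : KPlane → KPlane × ℝ}

theorem exists_equiv_tensor (h : IsCodazziImmersion F b X) {x : KPlane} (hx : x ∈ kleinDisc) :
    ∃ e : KPlane ≃L[ℝ] KPlane, (e : KPlane →L[ℝ] KPlane) = b x := by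
  have hinj : Function.Injective (b x : KPlane →ₗ[ℝ] KPlane) := by
    refine (injective_iff_map_eq_zero _).2 fun v hv => ?_
    by_contra hne
    exact h.tensor_ne_zero hx hne hv
  exact ⟨(LinearEquiv.ofInjectiveEndo (b x : KPlane →ₗ[ℝ] KPlane) hinj).toContinuousLinearEquiv,
    by ext1 v; rfl⟩

/-- `ContinuousLinearMap.inverse` is zero on non-invertible maps; this default never occurs on the
disc. -/
theorem tensor_inverse_apply (h : IsCodazziImmersion F b X) {x : KPlane} (hx : x ∈ kleinDisc)
    (v : KPlane) : b x ((b x).inverse v) = v := by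
  obtain ⟨e, he⟩ := h.exists_equiv_tensor hx
  rw [← he, ContinuousLinearMap.inverse_equiv]
  simp

theorem contDiffOn_tensor_inverse (h : IsCodazziImmersion F b X) :
    ContDiffOn ℝ ∞ (fun x => (b x).inverse) kleinDisc := by
  intro x hx
  obtain ⟨e, he⟩ := h.exists_equiv_tensor hx
  have h1 : ContDiffAt ℝ ∞ ContinuousLinearMap.inverse (b x) := by
    rw [← he]
    exact contDiffAt_map_inverse e
  exact h1.comp_contDiffWithinAt x (h.smooth_tensor x hx)

/-- The dual immersion, with the Klein metric as first fundamental form and with Gauss map the lift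
of `F` to the hyperboloid. -/
theorem exists_dual_immersion (h : IsCodazziImmersion F b X) :
    ∃ W : KPlane → KPlane × ℝ, ∀ x ∈ kleinDisc,
      HasFDerivAt W ((fderiv ℝ (fun y => hypLift (F y)) x).comp (b x).inverse) x := by
  have hP := h.contDiffOn_lift.fderiv_infty isOpen_kleinDisc
  have hX := h.contDiffOn.fderiv_infty isOpen_kleinDisc
  have hβ := h.contDiffOn_tensor_inverse
  refine convex_kleinDisc.exists_forall_hasFDerivAt_of_fderiv_symmetric isOpen_kleinDisc
    ((hP.clm_comp hβ).differentiableOn (by simp)) fun x hx u v => ?_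
  have hP1 := hP.differentiableAt_of_isOpen isOpen_kleinDisc hx
  have hX1 := hX.differentiableAt_of_isOpen isOpen_kleinDisc hx
  have hβ1 := hβ.differentiableAt_of_isOpen isOpen_kleinDisc hx
  -- As dX ∘ b⁻¹ = dN, its derivative is symmetric. The two Gauss formulas share their tangential
  -- parts, so this symmetry passes to dP ∘ b⁻¹; the remaining normal part is symmetric because `b`
  -- is.
  have eX : (fun y => (fderiv ℝ X y).comp (b y).inverse) =ᶠ[nhds x] fderiv ℝ hypLift := by
    filter_upwards [isOpen_kleinDisc.mem_nhds hx] with y hy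
    ext1 w
    rw [ContinuousLinearMap.comp_apply, h.fderiv_apply hy, h.tensor_inverse_apply hy]
  have hsym := contDiffOn_hypLift.fderiv_fderiv_comm isOpen_kleinDisc hx u v
  rw [← eX.fderiv_eq, (hX1.hasFDerivAt.clm_comp hβ1.hasFDerivAt).fderiv] at hsym
  rw [(hP1.hasFDerivAt.clm_comp hβ1.hasFDerivAt).fderiv]
  simp only [add_apply, ContinuousLinearMap.comp_apply, ContinuousLinearMap.flip_apply,
    ContinuousLinearMap.compL_apply] at hsym ⊢
  obtain ⟨c, hc1, hc2⟩ := h.exists_gauss_formula hx u ((b x).inverse v)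
  obtain ⟨c', hc1', hc2'⟩ := h.exists_gauss_formula hx v ((b x).inverse u)
  rw [h.tensor_inverse_apply hx] at hc1 hc2 hc1' hc2'
  rw [hc1, hc1', ← add_assoc, ← add_assoc, ← map_add, ← map_add, kleinMetric_symm x v u] at hsym
  have e := h.fderiv_injective hx (add_right_cancel hsym)
  rw [hc2, hc2', ← add_assoc, ← add_assoc, ← map_add, ← map_add, e, h.symm x hx,
    kleinMetric_symm x u]

end IsCodazziImmersion

/-- The immersion of a minimal Lagrangian map together with its dual immersion. -/
structure IsCodazziDualPair (F : KPlane → KPlane) (b : KPlane → KPlane →L[ℝ] KPlane)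
    (X W : KPlane → KPlane × ℝ) : Prop extends IsCodazziImmersion F b X where
  hasFDerivAt_dual : ∀ x ∈ kleinDisc,
    HasFDerivAt W ((fderiv ℝ (fun y => hypLift (F y)) x).comp (b x).inverse) x

namespace IsCodazziDualPair

variable {F : KPlane → KPlane} {b : KPlane → KPlane →L[ℝ] KPlane} {X W : KPlane → KPlane × ℝ}

theorem contDiffOn_dual (h : IsCodazziDualPair F b X W) : ContDiffOn ℝ ∞ W kleinDisc :=
  contDiffOn_of_hasFDerivAt isOpen_kleinDisc h.hasFDerivAt_dual
    ((h.contDiffOn_lift.fderiv_infty isOpen_kleinDisc).clm_comp h.contDiffOn_tensor_inverse)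

theorem contDiffOn_dual_fst (h : IsCodazziDualPair F b X W) :
    ContDiffOn ℝ ∞ (fun y => (W y).1) kleinDisc := h.contDiffOn_dual.fst

theorem fderiv_dual_apply (h : IsCodazziDualPair F b X W) {x : KPlane} (hx : x ∈ kleinDisc)
    (v : KPlane) :
    fderiv ℝ W x v = fderiv ℝ hypLift (F x) (fderiv ℝ F x ((b x).inverse v)) := by
  rw [(h.hasFDerivAt_dual x hx).fderiv, ContinuousLinearMap.comp_apply, h.fderiv_lift hx]

theorem fderiv_dual_fst_apply (h : IsCodazziDualPair F b X W) {x : KPlane} (hx : x ∈ kleinDisc)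
    (v : KPlane) : fderiv ℝ (fun y => (W y).1) x v =
      (fderiv ℝ hypLift (F x) (fderiv ℝ F x ((b x).inverse v))).1 := by
  rw [(HasFDerivAt.fst (h.contDiffOn_dual.differentiableAt_of_isOpen isOpen_kleinDisc
    hx).hasFDerivAt).fderiv, ContinuousLinearMap.comp_apply, h.fderiv_dual_apply hx]
  rfl

theorem kleinMetric_eq_dual (h : IsCodazziDualPair F b X W) {x : KPlane} (hx : x ∈ kleinDisc)
    (v w : KPlane) : kleinMetric x v w =
      inner ℝ (fderiv ℝ (fun y => (W y).1) x v) (fderiv ℝ (fun y => (W y).1) x w) -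
      inner ℝ (F x) (fderiv ℝ (fun y => (W y).1) x v) *
        inner ℝ (F x) (fderiv ℝ (fun y => (W y).1) x w) := by
  rw [h.fderiv_dual_fst_apply hx, h.fderiv_dual_fst_apply hx,
    ← minkForm_eq_of_snd (fderiv_hypLift_snd (h.mapsTo hx) _)
      (fderiv_hypLift_snd (h.mapsTo hx) _), minkForm_fderiv_hypLift (h.mapsTo hx), h.metric x hx,
    h.tensor_inverse_apply hx, h.tensor_inverse_apply hx]

/-- Forgetting the timelike component of a tangent vector can only increase its length, so the
horizontal projection expands the complete metric h. -/
theorem kleinMetric_le_dual (h : IsCodazziDualPair F b X W) {x : KPlane} (hx : x ∈ kleinDisc)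
    (v : KPlane) : kleinMetric x v v ≤ ‖fderiv ℝ (fun y => (W y).1) x v‖ ^ 2 := by
  rw [h.kleinMetric_eq_dual hx, real_inner_self_eq_norm_sq, ← sq]
  linarith [sq_nonneg (inner ℝ (F x) (fderiv ℝ (fun y => (W y).1) x v))]

theorem fderiv_dual_fst_ne_zero (h : IsCodazziDualPair F b X W) {x : KPlane} (hx : x ∈ kleinDisc)
    {v : KPlane} (hv : v ≠ 0) : fderiv ℝ (fun y => (W y).1) x v ≠ 0 := by
  intro h0
  have h1 := h.kleinMetric_le_dual hx v
  rw [h0, norm_zero] at h1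
  have := kleinMetric_pos hx hv
  norm_num at h1
  linarith

theorem isLocalHomeoWithin_dual_fst (h : IsCodazziDualPair F b X W) :
    IsLocalHomeoWithin (fun y => (W y).1) kleinDisc :=
  isLocalHomeoWithin_of_fderiv isOpen_kleinDisc h.contDiffOn_dual_fst
    fun _ hx _ hv => h.fderiv_dual_fst_ne_zero hx hv

/-- Since det b = 1, the metrics h and F^*h have the same area. The dual tangent plane is orthogonal
to (F x, 1), so its projection factor is governed by `F x` instead of `x`. -/
theorem abs_det_fderiv_dual_fst (h : IsCodazziDualPair F b X W) {x : KPlane}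
    (hx : x ∈ kleinDisc) : |(fderiv ℝ (fun y => (W y).1) x).det| =
      lorentzFactor (F x) ^ 4 * |(fderiv ℝ F x).det| := by
  set L := fderiv ℝ (fun y => (W y).1) x
  set u : KPlane := EuclideanSpace.single 0 1
  set v : KPlane := EuclideanSpace.single 1 1
  have h1 := minkForm_orthogonal_gram (F x) (L u) (L v)
  rw [← h.kleinMetric_eq_dual hx, ← h.kleinMetric_eq_dual hx, ← h.kleinMetric_eq_dual hx,
    ← det_eq_wedge] at h1
  have h2 := kleinMetric_gram hx u v u v
  rw [wedge_single, kleinMetric_symm x v u] at h2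
  have h3 := kleinMetric_gram hx (b x u) (b x v) (b x u) (b x v)
  rw [← det_eq_wedge, h.det_tensor hx] at h3
  have h4 := kleinMetric_gram (h.mapsTo hx) (fderiv ℝ F x u) (fderiv ℝ F x v) (fderiv ℝ F x u)
    (fderiv ℝ F x v)
  rw [h.metric x hx, h.metric x hx, h.metric x hx, h.metric x hx, h3, ← det_eq_wedge] at h4
  have hk := lorentzFactor_sq_mul (h.mapsTo hx)
  have h5 : L.det ^ 2 = (lorentzFactor (F x) ^ 4 * (fderiv ℝ F x).det) ^ 2 := by
    linear_combination -lorentzFactor (F x) ^ 2 * (h1 - h2) + lorentzFactor (F x) ^ 2 * h4 -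
      L.det ^ 2 * hk
  rw [(sq_eq_sq_iff_abs_eq_abs _ _).1 h5, abs_mul,
    abs_of_nonneg (pow_nonneg (lorentzFactor_pos (h.mapsTo hx)).le 4)]

/-- Along the lifted chord from `F x` to `F y` the pairing of W.1 with `F y - F x` has derivative
h(σ', bσ') divided by a Lorentz factor, which is nonnegative. -/
theorem inner_dual_sub_nonneg (h : IsCodazziDualPair F b X W) {x y : KPlane} (hx : x ∈ kleinDisc)
    (hy : y ∈ kleinDisc) : 0 ≤ inner ℝ ((W y).1 - (W x).1) (F y - F x) := by
  obtain ⟨σ, hσ, hσ1⟩ := h.exists_isSegmentLift hx hy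
  have hσs : ∀ r ∈ Ioo (0 : ℝ) 1, ContDiffAt ℝ ∞ σ r := fun r hr =>
    hσ.contDiffAt isOpen_kleinDisc h.smooth (fun _ hx _ hv => h.fderiv_ne_zero hx hv) hr
  have hσm : MapsTo σ (Ioo 0 1) kleinDisc := hσ.mapsTo.mono_left Ioo_subset_Icc_self
  have hd : ∀ r ∈ Ioo (0 : ℝ) 1, HasDerivAt (fun r => (inner ℝ (W (σ r)).1 (F y - F x) : ℝ))
      (inner ℝ (fderiv ℝ (fun y => (W y).1) (σ r) (deriv σ r)) (F y - F x)) r := by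
    intro r hr
    have h1 := hasDerivAt_comp_curve isOpen_kleinDisc h.contDiffOn_dual_fst isOpen_Ioo hσs hσm hr
    simpa using h1.1.inner ℝ (hasDerivAt_const r (F y - F x))
  have hnn : ∀ r ∈ Ioo (0 : ℝ) 1,
      0 ≤ inner ℝ (fderiv ℝ (fun y => (W y).1) (σ r) (deriv σ r)) (F y - F x) := by
    intro r hr
    have h1 := (hasDerivAt_comp_curve isOpen_kleinDisc h.smooth isOpen_Ioo hσs hσm hr).1
    have h2 : (fun r => F (σ r)) =ᶠ[nhds r] fun r => F x + r • (F y - F x) := by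
      filter_upwards [isOpen_Ioo.mem_nhds hr] with t ht using hσ.eq t (Ioo_subset_Icc_self ht)
    have h3 := ((hasDerivAt_id r).smul_const (F y - F x)).const_add (F x)
    rw [one_smul] at h3
    have h4 := h1.unique (h3.congr_of_eventuallyEq h2)
    have hx' := hσm hr
    rw [h.fderiv_dual_fst_apply hx', ← h4]
    refine nonneg_of_mul_nonneg_right ?_ (lorentzFactor_pos (h.mapsTo hx'))
    rw [inner_fderiv_hypLift (h.mapsTo hx'), h.metric _ hx', h.tensor_inverse_apply hx',
      ← h.symm _ hx']
    rcases eq_or_ne (deriv σ r) 0 with h0 | h0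
    · simp [h0, kleinMetric]
    · exact (h.pos _ hx' _ h0).le
  have hcont : ContinuousOn (fun r => (inner ℝ (W (σ r)).1 (F y - F x) : ℝ)) (Icc 0 1) :=
    (h.contDiffOn_dual_fst.continuousOn.comp hσ.continuousOn hσ.mapsTo).inner continuousOn_const
  have hmono := monotoneOn_of_deriv_nonneg (convex_Icc 0 1) hcont
    (fun r hr => by
      rw [interior_Icc] at hr
      exact (hd r hr).differentiableAt.differentiableWithinAt)
    (fun r hr => by
      rw [interior_Icc] at hr
      rw [(hd r hr).deriv]
      exact hnn r hr)
  have := hmono (left_mem_Icc.2 zero_le_one) (right_mem_Icc.2 zero_le_one) zero_le_one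
  simp only [hσ.zero, hσ1] at this
  rw [inner_sub_left]
  linarith

/-- The dual immersion is complete, so its projection is onto the plane. -/
theorem exists_dual_fst_eq (h : IsCodazziDualPair F b X W) (η : KPlane) :
    ∃ x ∈ kleinDisc, (W x).1 = η := by
  have hx : (0 : KPlane) ∈ kleinDisc := mem_kleinDisc.2 (by simp)
  set R := ‖η - (W 0).1‖ with hR
  -- Along a lift starting at the origin, -log(1 - |σ|²) starts at 0 and has derivative at most
  -- twice the h-speed, hence at most 2R. So 1 - |σ|² ≥ δ on the whole lift.
  set δ := Real.exp (-(2 * R)) with hδ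
  have hδ0 : 0 < δ := Real.exp_pos _
  have hKs : Metric.closedBall (0 : KPlane) (√(1 - δ)) ⊆ kleinDisc := by
    refine Metric.closedBall_subset_ball ?_
    rw [Real.sqrt_lt' one_pos]
    linarith
  obtain ⟨σ, hσ⟩ := h.isLocalHomeoWithin_dual_fst.exists_isSegmentLift_of_compact isOpen_kleinDisc
    (η := η) hx (isCompact_closedBall 0 (√(1 - δ))) hKs (by
    intro τ hτ σ hσ t ht
    have hσs : ∀ r ∈ Ioo (0 : ℝ) 1, ContDiffAt ℝ ∞ σ r := fun r hr =>
      hσ.contDiffAt isOpen_kleinDisc h.contDiffOn_dual_fst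
        (fun _ hx _ hv => h.fderiv_dual_fst_ne_zero hx hv) hr
    have hσm : MapsTo σ (Ioo 0 1) kleinDisc := hσ.mapsTo.mono_left Ioo_subset_Icc_self
    have hd : ∀ r ∈ Ioo (0 : ℝ) 1, HasDerivAt (fun r => -Real.log (1 - ‖σ r‖ ^ 2))
        (2 * (inner ℝ (σ r) (deriv σ r) / (1 - ‖σ r‖ ^ 2))) r := by
      intro r hr
      have h1 := ((hσs r hr).differentiableAt (by simp)).hasDerivAt.norm_sq
      have hpos := one_sub_norm_sq_pos (hσm hr)
      have h2 := ((h1.const_sub 1).log hpos.ne').neg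
      refine h2.congr_deriv ?_
      ring
    have hle : ∀ r ∈ Ioo (0 : ℝ) 1, inner ℝ (σ r) (deriv σ r) / (1 - ‖σ r‖ ^ 2) ≤ R := by
      intro r hr
      have hx' := hσm hr
      have h1 := (hasDerivAt_comp_curve isOpen_kleinDisc h.contDiffOn_dual_fst isOpen_Ioo hσs hσm
        hr).1
      have h2 : (fun r => (W (σ r)).1) =ᶠ[nhds r] fun r => (W 0).1 +
          r • ((W 0).1 + τ • (η - (W 0).1) - (W 0).1) := by
        filter_upwards [isOpen_Ioo.mem_nhds hr] with t ht using hσ.eq t (Ioo_subset_Icc_self ht)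
      have h3 := ((hasDerivAt_id r).smul_const
        ((W 0).1 + τ • (η - (W 0).1) - (W 0).1)).const_add (W 0).1
      rw [one_smul] at h3
      have h4 := h1.unique (h3.congr_of_eventuallyEq h2)
      have h5 := (inner_sq_div_le_kleinMetric hx' (deriv σ r)).trans (h.kleinMetric_le_dual hx' _)
      refine (abs_le_of_sq_le_sq' h5 (norm_nonneg _)).2.trans ?_
      rw [h4, add_sub_cancel_left, norm_smul, Real.norm_of_nonneg hτ.1, ← hR]
      exact mul_le_of_le_one_left (norm_nonneg _) hτ.2
    have hcont : ContinuousOn (fun r => -Real.log (1 - ‖σ r‖ ^ 2)) (Icc 0 1) := by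
      refine (ContinuousOn.log ?_ fun r hr => (one_sub_norm_sq_pos (hσ.mapsTo hr)).ne').neg
      exact continuousOn_const.sub (hσ.continuousOn.norm.pow 2)
    have hmv := (convex_Icc (0 : ℝ) 1).image_sub_le_mul_sub_of_deriv_le hcont
      (fun r hr => by
        rw [interior_Icc] at hr
        exact (hd r hr).differentiableAt.differentiableWithinAt) (C := 2 * R)
      (fun r hr => by
        rw [interior_Icc] at hr
        rw [(hd r hr).deriv]
        linarith [hle r hr]) 0 (left_mem_Icc.2 zero_le_one) t ht ht.1
    have hpos := one_sub_norm_sq_pos (hσ.mapsTo ht)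
    rw [hσ.zero] at hmv
    have hR0 : 0 ≤ R := norm_nonneg _
    have hlog : -(2 * R) ≤ Real.log (1 - ‖σ t‖ ^ 2) := by
      have : 2 * R * t ≤ 2 * R := by nlinarith [ht.2]
      simp at hmv
      linarith
    rw [Real.le_log_iff_exp_le hpos] at hlog
    rw [mem_closedBall_zero_iff]
    exact Real.le_sqrt_of_sq_le (by linarith))
  exact ⟨σ 1, hσ.mapsTo (right_mem_Icc.2 zero_le_one), hσ.map_one⟩

end IsCodazziDualPair

/-! ### The image is spanned by its ideal points. -/

/-- In finite dimension, a convex set and its closure have the same interior. -/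
theorem Convex.interior_closure_eq {E : Type*} [NormedAddCommGroup E] [NormedSpace ℝ E]
    [FiniteDimensional ℝ E] {s : Set E} (hs : Convex ℝ s) : interior (closure s) = interior s := by
  rcases (interior (closure s)).eq_empty_or_nonempty with h | h
  · rw [h]
    exact (subset_empty_iff.1 (h ▸ interior_mono subset_closure)).symm
  · refine hs.interior_closure_eq_interior_of_nonempty_interior ?_
    rw [hs.interior_nonempty_iff_affineSpan_eq_top]
    have hsub : closure s ⊆ affineSpan ℝ s :=
      closure_minimal (subset_affineSpan ℝ s) (AffineSubspace.closed_of_finiteDimensional _)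
    rw [hs.closure.interior_nonempty_iff_affineSpan_eq_top] at h
    exact top_le_iff.1 (h ▸ affineSpan_le.2 hsub)

namespace IsCodazziDualPair

variable {F : KPlane → KPlane} {b : KPlane → KPlane →L[ℝ] KPlane} {X W : KPlane → KPlane × ℝ}

open MeasureTheory in
/-- A half plane which cuts the image of `F` in a nonempty set does not cut off a part of it whose
closure lies in the open disc: the dual immersion maps this part onto a set containing a sector. -/
theorem not_subset_kleinDisc (h : IsCodazziDualPair F b X W) {e : KPlane} {c : ℝ} {x' : KPlane}
    (hx' : x' ∈ kleinDisc) (hc : c < inner ℝ e (F x'))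
    (hcap : closure (F '' kleinDisc) ∩ {y | c ≤ inner ℝ e y} ⊆ kleinDisc) : False := by
  set C := closure (F '' kleinDisc) ∩ {y : KPlane | c ≤ inner ℝ e y} with hC
  have hbdd : Bornology.IsBounded (F '' kleinDisc) :=
    Metric.isBounded_ball.subset h.mapsTo.image_subset
  have hCc : IsCompact C := (hbdd.isCompact_closure).inter_right
    (isClosed_le continuous_const (by fun_prop))
  obtain ⟨M, hM⟩ := hCc.exists_bound_of_continuousOn (f := fun y => lorentzFactor y ^ 4)
    (fun y hy => ((contDiffAt_lorentzFactor (hcap hy)).continuousAt.pow 4).continuousWithinAt)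
  set V := kleinDisc ∩ F ⁻¹' {y : KPlane | c < inner ℝ e y} with hV
  have hVo : IsOpen V := h.smooth.continuousOn.isOpen_inter_preimage isOpen_kleinDisc
    (isOpen_lt continuous_const (by fun_prop))
  have hVC : ∀ x ∈ V, F x ∈ C := fun x hx => by
    have hlt : c < inner ℝ e (F x) := hx.2
    exact ⟨subset_closure (mem_image_of_mem F hx.1), hlt.le⟩
  -- On the compact cap the Lorentz factor is bounded, so W.1 inflates area by at most `M` relative
  -- to the injective map `F`, whose image lies in the unit disc.
  have hfin : volume ((fun y => (W y).1) '' V) ≤ ENNReal.ofReal M * volume kleinDisc := by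
    have h1 := addHaar_image_le_lintegral_abs_det_fderiv volume hVo.measurableSet
      (f := fun y => (W y).1) (fun x hx => (h.contDiffOn_dual_fst.differentiableAt_of_isOpen
        isOpen_kleinDisc hx.1).hasFDerivAt.hasFDerivWithinAt)
    refine h1.trans ?_
    have h2 := lintegral_abs_det_fderiv_eq_addHaar_image volume hVo.measurableSet (f := F)
      (fun x hx => (h.smooth.differentiableAt_of_isOpen isOpen_kleinDisc
        hx.1).hasFDerivAt.hasFDerivWithinAt) (h.injOn.mono inter_subset_left)
    calc ∫⁻ x in V, ENNReal.ofReal |(fderiv ℝ (fun y => (W y).1) x).det|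
        ≤ ∫⁻ x in V, ENNReal.ofReal M * ENNReal.ofReal |(fderiv ℝ F x).det| := by
          refine setLIntegral_mono' hVo.measurableSet fun x hx => ?_
          rw [h.abs_det_fderiv_dual_fst hx.1, ENNReal.ofReal_mul
            (pow_nonneg (lorentzFactor_pos (h.mapsTo hx.1)).le 4)]
          gcongr
          exact (le_abs_self _).trans (hM _ (hVC x hx))
      _ = ENNReal.ofReal M * volume (F '' V) := by
          rw [lintegral_const_mul' _ _ ENNReal.ofReal_ne_top, h2]
      _ ≤ ENNReal.ofReal M * volume kleinDisc := by
          gcongr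
          rintro _ ⟨x, hx, rfl⟩
          exact h.mapsTo hx.1
  set δ := inner ℝ e (F x') - c with hδ
  have hδ0 : 0 < δ := sub_pos.2 hc
  set D := ‖(W x').1‖ with hD
  -- Write η = W.1(x) by surjectivity. Monotonicity against `x'` bounds r⟪e, F x - F x'⟫ below by
  -- -2(rδ/8) - 2D, the 2 being the diameter of the disc. Since 8D < rδ this exceeds -rδ/2, so `F x`
  -- stays in the half plane.
  have hsector : ∀ r : ℝ, 8 * D / δ < r → 0 < r →
      Metric.ball (r • e) (r * (δ / 8)) ⊆ (fun y => (W y).1) '' V := by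
    intro r hr hr0 η hη
    obtain ⟨x, hx, rfl⟩ := h.exists_dual_fst_eq η
    refine ⟨x, ⟨hx, ?_⟩, rfl⟩
    have h1 := h.inner_dual_sub_nonneg hx' hx
    have hn : ‖F x - F x'‖ ≤ 2 := (norm_sub_le _ _).trans (by
      linarith [mem_kleinDisc.1 (h.mapsTo hx), mem_kleinDisc.1 (h.mapsTo hx')])
    have h2 : inner ℝ ((W x).1 - r • e) (F x - F x') ≤ r * (δ / 8) * 2 := by
      have h3 : ‖(W x).1 - r • e‖ < r * (δ / 8) := by simpa [dist_eq_norm] using hη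
      exact (real_inner_le_norm _ _).trans (mul_le_mul h3.le hn (norm_nonneg _) (by positivity))
    have h4 : -(D * 2) ≤ inner ℝ (W x').1 (F x - F x') := by
      have := abs_real_inner_le_norm (W x').1 (F x - F x')
      have h5 := neg_le_of_abs_le this
      have h6 := mul_le_mul_of_nonneg_left hn (norm_nonneg (W x').1)
      linarith
    have h7 : inner ℝ ((W x).1 - (W x').1) (F x - F x') =
        inner ℝ ((W x).1 - r • e) (F x - F x') + r * (inner ℝ e (F x) - inner ℝ e (F x')) -
          inner ℝ (W x').1 (F x - F x') := by
      simp only [inner_sub_left, inner_sub_right, real_inner_smul_left]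
      ring
    have h8 : 8 * D < r * δ := by rwa [div_lt_iff₀ hδ0] at hr
    have h9 : 0 < r * (inner ℝ e (F x) - c) := by
      have : inner ℝ e (F x) - c = inner ℝ e (F x) - inner ℝ e (F x') + δ := by rw [hδ]; ring
      rw [this]
      nlinarith
    have h10 := pos_of_mul_pos_right h9 hr0.le
    show c < inner ℝ e (F x)
    linarith
  have hvol : ENNReal.ofReal M * volume kleinDisc < ⊤ :=
    ENNReal.mul_lt_top ENNReal.ofReal_lt_top measure_ball_lt_top
  set A := ENNReal.ofReal M * volume kleinDisc with hA
  have hbound : ∀ r : ℝ, 8 * D / δ < r → 0 < r →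
      (r * (δ / 8)) ^ 2 * (volume (Metric.ball (0 : KPlane) 1)).toReal ≤ A.toReal := by
    intro r hr hr0
    have h1 := (measure_mono (μ := volume) (hsector r hr hr0)).trans hfin
    rw [Measure.addHaar_ball _ _ (by positivity), finrank_euclideanSpace, Fintype.card_fin] at h1
    have h2 := ENNReal.toReal_mono hvol.ne h1
    rwa [ENNReal.toReal_mul, ENNReal.toReal_ofReal (by positivity)] at h2
  set ν := (volume (Metric.ball (0 : KPlane) 1)).toReal with hν
  have hν0 : 0 < ν := ENNReal.toReal_pos (Metric.measure_ball_pos volume _ one_pos).ne'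
    measure_ball_lt_top.ne
  have htend : Filter.Tendsto (fun r : ℝ => (r * (δ / 8)) ^ 2 * ν) Filter.atTop Filter.atTop :=
    ((Filter.tendsto_pow_atTop two_ne_zero).comp
      (Filter.tendsto_id.atTop_mul_const (by positivity))).atTop_mul_const hν0
  obtain ⟨r, hr1, hr2, hr3⟩ := ((htend.eventually_gt_atTop A.toReal).and
    ((Filter.eventually_gt_atTop (8 * D / δ)).and (Filter.eventually_gt_atTop 0))).exists
  exact absurd (hbound r hr2 hr3) (not_le.2 hr1)

/-- A point of the closed image outside the closed hull would be separated from it by a half plane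
free of ideal points. That half plane meets the image itself, and the cap it cuts off lies in the
open disc, contrary to `not_subset_kleinDisc`. -/
theorem closure_image_eq (h : IsCodazziDualPair F b X W) : closure (F '' kleinDisc) =
    closure (convexHull ℝ (closure (F '' kleinDisc) ∩ kleinBoundary)) := by
  refine Subset.antisymm (fun k hk => ?_) (closure_minimal
    (convexHull_min inter_subset_left h.convex_image.closure) isClosed_closure)
  by_contra hk'
  obtain ⟨f, c, hfc, hck⟩ := geometric_hahn_banach_closed_point
    (convex_convexHull ℝ _).closure isClosed_closure hk'
  set e := (InnerProductSpace.toDual ℝ KPlane).symm f with he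
  have hfe : ∀ y, inner ℝ e y = f y := fun y => InnerProductSpace.toDual_symm_apply
  obtain ⟨_, hx', x', hx'D, rfl⟩ := mem_closure_iff.1 hk {y | c < inner ℝ e y}
    (isOpen_lt continuous_const (by fun_prop)) (by simpa [hfe] using hck)
  refine h.not_subset_kleinDisc hx'D hx' fun y hy => mem_kleinDisc.2 ?_
  have hy1 : ‖y‖ ≤ 1 := by
    have : closure (F '' kleinDisc) ⊆ Metric.closedBall 0 1 :=
      closure_minimal (h.mapsTo.image_subset.trans Metric.ball_subset_closedBall)
        Metric.isClosed_closedBall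
    simpa using this hy.1
  refine lt_of_le_of_ne hy1 fun hy2 => ?_
  have := hfc y (subset_closure (subset_convexHull ℝ _ ⟨hy.1, by simpa [kleinBoundary] using hy2⟩))
  have hy3 : c ≤ inner ℝ e y := hy.2
  rw [hfe] at hy3
  exact absurd this (not_lt.2 hy3)

theorem interior_convexHull_eq (h : IsCodazziDualPair F b X W) :
    interior (convexHull ℝ (closure (F '' kleinDisc) ∩ kleinBoundary)) = F '' kleinDisc := by
  rw [← (convex_convexHull ℝ _).interior_closure_eq, ← h.closure_image_eq,
    h.convex_image.interior_closure_eq, h.isOpen_image.interior_eq]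

end IsCodazziDualPair

theorem IsMinimalLagrangian.exists_isCodazziDualPair {F : KPlane → KPlane}
    (hF : IsMinimalLagrangian F) : ∃ b X W, IsCodazziDualPair F b X W := by
  obtain ⟨b, hb⟩ := hF.exists_isCodazziPair
  obtain ⟨X, hX⟩ := hb.exists_immersion
  have h : IsCodazziImmersion F b X := ⟨hb, hX⟩
  obtain ⟨W, hW⟩ := h.exists_dual_immersion
  exact ⟨b, X, W, h, hW⟩

end

theorem corollaryG (F : KPlane → KPlane) (hF : IsMinimalLagrangian F) :
    IsDiffeoOnto F kleinDisc
      (interior (convexHull ℝ (closure (F '' kleinDisc) ∩ kleinBoundary))) := by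
  obtain ⟨b, X, W, h⟩ := hF.exists_isCodazziDualPair
  rw [h.interior_convexHull_eq]
  exact h.isDiffeoOnto_image
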